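/- Theorem 1.2 (restated as Theorem 3.6). Assume $\diamondsuit_{\aleph_1}$: there are sets $A_\alpha\subseteq\alpha$ ($\alpha<\omega_1$) such that for every $X\subseteq\omega_1$ the set $\{\alpha<\omega_1 : X\cap\alpha=A_\alpha\}$ is stationary. Let $R$ be a countable principal ideal domain that is not a field, and write $M^*=\operatorname{Hom}_R(M,R)$. Then there is an $R$-module $G$ of cardinality $\aleph_1$ such that (a) $G$ is reflexive, i.e. the evaluation map $G\to G^{**}$ is an isomorphism; (b) $G\not\cong R\oplus G$; (c) there are an $R$-module $H$ and a non-degenerate bilinear form $\Phi:G\oplus H\to R$ (that is, $\Phi(g,\cdot)=0$ only for $g=0$, and $\Phi(\cdot,h)=0$ only for $h=0$) which is the union of an ascending continuous chain of its restrictions $\Phi_\alpha:G_\alpha\oplus H_\alpha\to R$ ($\alpha<\omega_1$), where $G_\alpha\le G$ and $H_\alpha\le H$ are submodules and $G_\alpha\oplus H_\alpha$ is pure in $G_\beta\oplus H_\beta$ for $\alpha\le\beta$, such that for each $\alpha$: the modules $G_\alpha,H_\alpha$ are free of countable rank; $\Phi_\alpha$ is non-degenerate and preserves purity (if $g$ is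 pure in $G_\alpha$, then $\Phi_\alpha(g,\cdot)$ is pure in $H_\alpha^*$, and dually); and $\Phi_\alpha$ is finitely covered (for every pure submodule $L\le G_\alpha$ of finite rank and every $f\in L^*$ there is $h\in H_\alpha$ with $\Phi_\alpha(\cdot,h)|_L=f$, and dually with the roles of $G_\alpha$ and $H_\alpha$ exchanged). Here a submodule $N\le M$ is pure if $rM\cap N\subseteq rN$ for all $r\in R$, and an element $m\in M$ is pure if $Rm$ is a pure submodule of $M$. In particular $G$ is a dual module ($G\cong D^*$ for some $R$-module $D$) with $G\not\cong R\oplus G$; for $R=\mathbb Z$ this is a dual abelian group $G$ not isomorphic to $\mathbb Z\oplus G$. -/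

import Mathlib

open Cardinal Ordinal Order

universe u

/-- Jensen's diamond principle for `ℵ₁`: there are sets `A α ⊆ α` (for `α < ω₁`) such that every
`X ⊆ ω₁` satisfies `X ∩ α = A α` for stationarily many `α < ω₁`. Here `ω₁` is the well-ordered set
of all ordinals below `ω₁`, and an ordinal `α < ω₁` is the set `Set.Iio α` of its predecessors. -/
def DiamondAlephOne : Prop :=
  ∃ A : Set.Iio (ω₁ : Ordinal.{0}) → Set (Set.Iio (ω₁ : Ordinal.{0})),
    (∀ α, A α ⊆ Set.Iio α) ∧
      ∀ X : Set (Set.Iio (ω₁ : Ordinal.{0})), IsStationary {α | X ∩ Set.Iio α = A α}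

section Forms

variable {R : Type u} [CommRing R]

/-- A submodule `N` of `M` is pure if `rM ∩ N ⊆ rN` for all scalars `r`. -/
def IsPureSubmodule {M : Type u} [AddCommGroup M] [Module R M] (N : Submodule R M) : Prop :=
  ∀ (r : R) (m : M), r • m ∈ N → ∃ n ∈ N, r • n = r • m

variable (R) in
/-- An element is pure if the cyclic submodule that it generates is pure. -/
def IsPureElement {M : Type u} [AddCommGroup M] [Module R M] (m : M) : Prop :=
  IsPureSubmodule (Submodule.span R {m})

variable {G H : Type u} [AddCommGroup G] [Module R G] [AddCommGroup H] [Module R H]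

/-- The class `𝔉` of bilinear forms `Φ : G ⊕ H → R`: both parts are free of countable rank, and
`Φ` is non-degenerate and preserves purity on both sides. -/
structure IsCountableForm (Φ : G →ₗ[R] H →ₗ[R] R) : Prop where
  free_left : Module.Free R G
  free_right : Module.Free R H
  rank_left : Module.rank R G ≤ ℵ₀
  rank_right : Module.rank R H ≤ ℵ₀
  nondegenerate : Φ.Nondegenerate
  pure_left : ∀ g : G, IsPureElement R g → IsPureElement R (Φ g)
  pure_right : ∀ h : H, IsPureElement R h → IsPureElement R (Φ.flip h)

/-- Every linear functional on a pure submodule `L` of finite rank of the left part is the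
restriction to `L` of `Φ(·, h)` for some `h` in the right part. -/
def IsFinitelyCoveredLeft (Φ : G →ₗ[R] H →ₗ[R] R) : Prop :=
  ∀ L : Submodule R G, IsPureSubmodule L → Module.rank R L < ℵ₀ →
    ∀ f : L →ₗ[R] R, ∃ h : H, ∀ x : L, Φ x h = f x

/-- A form is finitely covered if it is finitely covered on the left and on the right. -/
def IsFinitelyCovered (Φ : G →ₗ[R] H →ₗ[R] R) : Prop :=
  IsFinitelyCoveredLeft Φ ∧ IsFinitelyCoveredLeft Φ.flip

/-- `Φ : G ⊕ H → R` is the union of the ascending continuous chain of its restrictions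
`Φ α : G α ⊕ H α → R` (`α < ω₁`), each of which is a finitely covered form in the class `𝔉`, and
the domain of each of which is pure in the domains of the later ones. -/
structure IsUnionOfFormChain (Φ : G →ₗ[R] H →ₗ[R] R)
    (Gs : Set.Iio (ω₁ : Ordinal.{0}) → Submodule R G)
    (Hs : Set.Iio (ω₁ : Ordinal.{0}) → Submodule R H) : Prop where
  mono_left : Monotone Gs
  mono_right : Monotone Hs
  continuous_left : ∀ α, IsSuccLimit α → Gs α = ⨆ β, ⨆ _ : β < α, Gs β
  continuous_right : ∀ α, IsSuccLimit α → Hs α = ⨆ β, ⨆ _ : β < α, Hs β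
  union_left : ⨆ α, Gs α = ⊤
  union_right : ⨆ α, Hs α = ⊤
  pure_left : ∀ α β, α ≤ β → IsPureSubmodule ((Gs α).submoduleOf (Gs β))
  pure_right : ∀ α β, α ≤ β → IsPureSubmodule ((Hs α).submoduleOf (Hs β))
  isCountableForm : ∀ α, IsCountableForm (Φ.domRestrict₁₂ (Gs α) (Hs α))
  isFinitelyCovered : ∀ α, IsFinitelyCovered (Φ.domRestrict₁₂ (Gs α) (Hs α))

end Forms

-- Fix a nonzero non-unit `p`; the `p`-adic topology of `R` is separated. Both sides of the form are
-- built inside `ℕ → R`, the pairing of `x` and `z` being the `p`-adic sum of the products `x i * z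
-- i`, required to converge in `R`. They are unions of a continuous chain of countable pairs
-- containing the finitely supported sequences and satisfying a splitting condition: every nonzero
-- element of either side is a multiple `r • c`, where `c` pairs to `1` with some element of the
-- other side. Splitting passes to directed unions. By a Gram–Schmidt process it gives dual bases
-- (`exists_dual_bases`), hence freeness; it also gives finite covering and preservation of purity.
--
-- A stage with dual bases `e`, `f` is enlarged on the left by `y 0 = ∑ p ^ k j • e j` and the
-- quotients of its tails by `p ^ k n` (`GoodPair.exists_extension`). An extension of a functional
-- `φ` sends `y 0` to the `p`-adic limit of the sums of `p ^ k j • φ (e j)`. If `φ` is not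
-- represented by the right side, then `φ (e j) ≠ 0` infinitely often, and a Baire category argument
-- (`exists_strictMono_avoiding`) yields `k` for which this limit is none of the countably many
-- elements of `R`, so `φ` does not extend.
--
-- An injective endomorphism `η` with adjoint and non-torsion cokernel is killed in two steps. A
-- Baire choice of `k` ensures that no element of the enlarged left side plays the role of `η (y
-- 0)`; then the functional that this element would induce on the right side is killed by enlarging
-- the right side.
--
-- Diamond predicts functionals on either side and endomorphisms of the left side, and each stage of
-- the chain deals with its prediction. Hence every functional on either side of the union is
-- represented, so the form is a perfect pairing and `G` is reflexive and dual. Every injective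
-- endomorphism of `G` has torsion cokernel, whereas an isomorphism of `G` with `R × G` would give
-- one with cokernel `R`. This also makes `G` uncountable, since a countable union would equal a
-- stage, which is free of infinite rank.

universe v

/-! ### Split forms: dual bases, purity and finite covering -/

section SplitForms

variable {R : Type u} [CommRing R]
variable {M N : Type u} [AddCommGroup M] [Module R M] [AddCommGroup N] [Module R N]

/-- Every nonzero element of the left part is a multiple of an element `c` for which the functional
`Φ c` takes the value `1`. -/
def SplitsLeft (Φ : M →ₗ[R] N →ₗ[R] R) : Prop :=
  ∀ g : M, g ≠ 0 → ∃ (r : R) (c : M) (h : N), g = r • c ∧ Φ c h = 1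

/-- A set of pairs is a dual system for `Φ` if its first and second components are dual. -/
def IsDualSystem (Φ : M →ₗ[R] N →ₗ[R] R) (s : Set (M × N)) : Prop :=
  ∀ a ∈ s, ∀ b ∈ s, (a = b → Φ a.1 b.2 = 1) ∧ (a ≠ b → Φ a.1 b.2 = 0)

variable {Φ : M →ₗ[R] N →ₗ[R] R}

theorem IsDualSystem.swap {s : Set (M × N)} (hs : IsDualSystem Φ s) :
    IsDualSystem Φ.flip (Prod.swap '' s) := by
  rintro _ ⟨a, ha, rfl⟩ _ ⟨b, hb, rfl⟩
  refine ⟨fun h => (hs b hb a ha).1 (Prod.swap_injective h).symm, fun h => ?_⟩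
  exact (hs b hb a ha).2 fun h' => h (by rw [h'])

theorem IsDualSystem.linearIndependent {s : Set (M × N)} (hs : IsDualSystem Φ s) :
    LinearIndependent R (fun a : s => a.1.1) := by
  rw [linearIndependent_iff']
  intro t c hc i hi
  have := congrArg (fun x => Φ x i.1.2) hc
  simp only [map_sum, map_smul, LinearMap.sum_apply, LinearMap.smul_apply, map_zero,
    LinearMap.zero_apply] at this
  rw [Finset.sum_eq_single i] at this
  · simpa [(hs i i.2 i i.2).1 rfl] using this
  · intro b _ hb
    rw [(hs b b.2 i i.2).2 (fun h => hb (Subtype.ext h)), smul_zero]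
  · exact fun h => (h hi).elim

theorem LinearIndependent.of_dual {ι : Type*} {e : ι → M} {f : ι → N}
    (h1 : ∀ i, Φ (e i) (f i) = 1) (h0 : ∀ i j, i ≠ j → Φ (e i) (f j) = 0) :
    LinearIndependent R e := by
  rw [linearIndependent_iff']
  intro t c hc i hi
  have := congrArg (fun x => Φ x (f i)) hc
  simp only [map_sum, map_smul, LinearMap.sum_apply, LinearMap.smul_apply, map_zero,
    LinearMap.zero_apply] at this
  rw [Finset.sum_eq_single i] at this
  · simpa [h1 i] using this
  · intro b _ hb
    rw [h0 b i hb, smul_zero]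
  · exact fun h => (h hi).elim

theorem SplitsLeft.separatingLeft (hΦ : SplitsLeft Φ) : Φ.SeparatingLeft := by
  intro g hg
  by_contra hne
  obtain ⟨r, c, h, rfl, hc⟩ := hΦ g hne
  have := hg h
  rw [map_smul, LinearMap.smul_apply, hc, _root_.smul_eq_mul, mul_one] at this
  exact hne (by rw [this, zero_smul])

theorem not_finite_of_dual [Nontrivial R] {e : ℕ → M} {f : ℕ → N}
    (h1 : ∀ i, Φ (e i) (f i) = 1) (h0 : ∀ i j, i ≠ j → Φ (e i) (f j) = 0) :
    ¬ Module.Finite R M := by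
  intro h
  have h1 := (LinearIndependent.of_dual h1 h0).aleph0_le_rank
  exact absurd (Module.rank_lt_aleph0 R M) (not_lt.2 h1)

variable [IsDomain R]

/-- One Gram–Schmidt step. Subtract from `g` its projection `w` to the span and split the remainder
as `r • c`; cancelling `r` shows that `c` is orthogonal to the old second components. The partner of
`c` is then corrected by a projection on the other side. -/
theorem IsDualSystem.exists_insert {s : Set (M × N)} (hsf : s.Finite)
    (hs : IsDualSystem Φ s) (hΦ : SplitsLeft Φ) {g : M}
    (hg : g ∉ Submodule.span R (Prod.fst '' s)) :
    ∃ (c : M) (h : N) (r : R), (c, h) ∉ s ∧ IsDualSystem Φ (insert (c, h) s) ∧ r ≠ 0 ∧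
      g - r • c ∈ Submodule.span R (Prod.fst '' s) := by
  classical
  lift s to Finset (M × N) using hsf
  simp only [Finset.mem_coe] at *
  have key : ∀ (b : M × N), b ∈ s → ∀ (c : M × N → R),
      ∑ a ∈ s, c a * Φ a.1 b.2 = c b := by
    intro b hb c
    rw [Finset.sum_eq_single b]
    · rw [(hs b hb b hb).1 rfl, mul_one]
    · intro a ha hab
      rw [(hs a ha b hb).2 hab, mul_zero]
    · exact fun h => (h hb).elim
  have key' : ∀ (b : M × N), b ∈ s → ∀ (c : M × N → R),
      ∑ a ∈ s, c a * Φ b.1 a.2 = c b := by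
    intro b hb c
    rw [Finset.sum_eq_single b]
    · rw [(hs b hb b hb).1 rfl, mul_one]
    · intro a ha hab
      rw [(hs b hb a ha).2 hab.symm, mul_zero]
    · exact fun h => (h hb).elim
  set w : M := ∑ a ∈ s, Φ g a.2 • a.1 with hw
  have hwmem : w ∈ Submodule.span R (Prod.fst '' (s : Set (M × N))) :=
    Submodule.sum_mem _ fun a ha => Submodule.smul_mem _ _ (Submodule.subset_span ⟨a, ha, rfl⟩)
  have hne : g - w ≠ 0 := fun h => hg (by rw [sub_eq_zero.1 h]; exact hwmem)
  have horth : ∀ b ∈ s, Φ (g - w) b.2 = 0 := by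
    intro b hb
    simp [hw, key b hb (fun a => Φ g a.2)]
  obtain ⟨r, c, h0, hr, hc⟩ := hΦ _ hne
  have hr0 : r ≠ 0 := by
    rintro rfl
    exact hne (by rw [hr, zero_smul])
  have hcb : ∀ b ∈ s, Φ c b.2 = 0 := by
    intro b hb
    have := horth b hb
    rw [hr] at this
    simpa [hr0] using this
  set z : N := ∑ a ∈ s, Φ a.1 h0 • a.2 with hz
  have hbz : ∀ b ∈ s, Φ b.1 (h0 - z) = 0 := by
    intro b hb
    simp [hz, key' b hb (fun a => Φ a.1 h0)]
  have hcz : Φ c (h0 - z) = 1 := by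
    have : Φ c z = 0 := by
      rw [hz, map_sum]
      exact Finset.sum_eq_zero fun a ha => by rw [map_smul, hcb a ha, smul_zero]
    rw [map_sub, hc, this, _root_.sub_zero]
  have hnot : (c, h0 - z) ∉ s := by
    intro h
    have := hbz _ h
    simp only at this
    rw [hcz] at this
    exact one_ne_zero this
  refine ⟨c, h0 - z, r, hnot, ?_, hr0, ?_⟩
  · rintro a (rfl | ha) b (rfl | hb)
    · exact ⟨fun _ => hcz, fun h => (h rfl).elim⟩
    · exact ⟨fun h => (hnot (h ▸ hb)).elim, fun _ => hcb b hb⟩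
    · exact ⟨fun h => (hnot (h ▸ ha)).elim, fun _ => hbz a ha⟩
    · exact hs a ha b hb
  · rw [← hr, sub_sub_cancel]
    exact hwmem

theorem SplitsLeft.smul_eq_zero (hΦ : SplitsLeft Φ) {r : R} {m : M} (h : r • m = 0) :
    r = 0 ∨ m = 0 := by
  by_cases hm : m = 0
  · exact Or.inr hm
  · obtain ⟨s, c, y, rfl, hc⟩ := hΦ m hm
    have := congrArg (fun x => Φ x y) h
    simp only [map_smul, LinearMap.smul_apply, hc, _root_.smul_eq_mul, mul_one, map_zero,
      LinearMap.zero_apply, mul_eq_zero] at this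
    rcases this with h | h
    · exact Or.inl h
    · exact (hm (by rw [h, zero_smul])).elim

theorem SplitsLeft.smul_left_cancel (hΦ : SplitsLeft Φ) {r : R} (hr : r ≠ 0) {m n : M}
    (h : r • m = r • n) : m = n := by
  rw [← sub_eq_zero, ← smul_sub] at h
  exact sub_eq_zero.1 ((hΦ.smul_eq_zero h).resolve_left hr)

theorem IsDualSystem.exists_superset_left {s : Set (M × N)} (hsf : s.Finite)
    (hs : IsDualSystem Φ s) (hΦ : SplitsLeft Φ) (g : M) :
    ∃ t : Set (M × N), s ⊆ t ∧ t.Finite ∧ IsDualSystem Φ t ∧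
      g ∈ Submodule.span R (Prod.fst '' t) := by
  by_cases hg : g ∈ Submodule.span R (Prod.fst '' s)
  · exact ⟨s, subset_rfl, hsf, hs, hg⟩
  · obtain ⟨c, h, r, -, hd, -, hgc⟩ := hs.exists_insert hsf hΦ hg
    refine ⟨insert (c, h) s, Set.subset_insert _ _, hsf.insert _, hd, ?_⟩
    rw [← sub_add_cancel g (r • c)]
    refine Submodule.add_mem _ ?_ (Submodule.smul_mem _ _ (Submodule.subset_span ?_))
    · exact Submodule.span_mono (Set.image_mono (Set.subset_insert _ _)) hgc
    · exact ⟨(c, h), Set.mem_insert _ _, rfl⟩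

theorem IsDualSystem.exists_superset {s : Set (M × N)} (hsf : s.Finite)
    (hs : IsDualSystem Φ s) (hΦ : SplitsLeft Φ) (hΦ' : SplitsLeft Φ.flip) (g : M) (h : N) :
    ∃ t : Set (M × N), s ⊆ t ∧ t.Finite ∧ IsDualSystem Φ t ∧
      g ∈ Submodule.span R (Prod.fst '' t) ∧ h ∈ Submodule.span R (Prod.snd '' t) := by
  obtain ⟨t, hst, htf, ht, hg⟩ := hs.exists_superset_left hsf hΦ g
  obtain ⟨t', htt', ht'f, ht', hh⟩ := ht.swap.exists_superset_left (htf.image _) hΦ' h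
  have htt : t ⊆ Prod.swap '' t' := by
    intro a ha
    exact ⟨a.swap, htt' ⟨a, ha, rfl⟩, Prod.swap_swap a⟩
  refine ⟨Prod.swap '' t', hst.trans htt, ht'f.image _, ht'.swap, ?_, ?_⟩
  · exact Submodule.span_mono (Set.image_mono htt) hg
  · rwa [Set.image_image]

/-- Back and forth: enumerate both sides and enlarge a finite dual system so that the `n`-th
elements enter the two spans. The union is a dual system spanning both sides, and it is infinite
because `M` is not finitely generated. -/
theorem exists_dual_bases [Countable M] [Countable N] (hΦ : SplitsLeft Φ)
    (hΦ' : SplitsLeft Φ.flip) (hfin : ¬ Module.Finite R M) :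
    ∃ (b : Module.Basis ℕ R M) (b' : Module.Basis ℕ R N),
      ∀ i j, Φ (b i) (b' j) = if i = j then 1 else 0 := by
  obtain ⟨gs, hgs⟩ := exists_surjective_nat M
  obtain ⟨hs, hhs⟩ := exists_surjective_nat N
  have step : ∀ (n : ℕ) (s : {s : Set (M × N) // s.Finite ∧ IsDualSystem Φ s}),
      ∃ t : {s : Set (M × N) // s.Finite ∧ IsDualSystem Φ s}, s.1 ⊆ t.1 ∧
        gs n ∈ Submodule.span R (Prod.fst '' t.1) ∧ hs n ∈ Submodule.span R (Prod.snd '' t.1) := by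
    rintro n ⟨s, hsf, hs'⟩
    obtain ⟨t, h1, h2, h3, h4, h5⟩ := hs'.exists_superset hsf hΦ hΦ' (gs n) (hs n)
    exact ⟨⟨t, h2, h3⟩, h1, h4, h5⟩
  choose T hT1 hT2 hT3 using step
  let S : ℕ → {s : Set (M × N) // s.Finite ∧ IsDualSystem Φ s} :=
    fun n => Nat.rec ⟨∅, Set.finite_empty, fun a ha => ha.elim⟩ T n
  have hSmono : Monotone fun n => (S n).1 := monotone_nat_of_le_succ fun n => hT1 n (S n)
  set D : Set (M × N) := ⋃ n, (S n).1 with hD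
  have hsub : ∀ n, (S n).1 ⊆ D := fun n => Set.subset_iUnion (fun n => (S n).1) n
  have hDdual : IsDualSystem Φ D := by
    intro a ha b hb
    obtain ⟨i, hi⟩ := Set.mem_iUnion.1 ha
    obtain ⟨j, hj⟩ := Set.mem_iUnion.1 hb
    exact (S (max i j)).2.2 a (hSmono (le_max_left i j) hi) b (hSmono (le_max_right i j) hj)
  have hspan1 : Submodule.span R (Prod.fst '' D) = ⊤ := by
    rw [eq_top_iff]
    rintro g -
    obtain ⟨n, rfl⟩ := hgs g
    exact Submodule.span_mono (Set.image_mono (hsub (n + 1))) (hT2 n (S n))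
  have hspan2 : Submodule.span R (Prod.snd '' D) = ⊤ := by
    rw [eq_top_iff]
    rintro h -
    obtain ⟨n, rfl⟩ := hhs h
    exact Submodule.span_mono (Set.image_mono (hsub (n + 1))) (hT3 n (S n))
  have hDinf : D.Infinite := by
    intro hDf
    refine hfin ⟨⟨(hDf.image Prod.fst).toFinset, ?_⟩⟩
    rw [Set.Finite.coe_toFinset, hspan1]
  have : Infinite D := hDinf.to_subtype
  have : Countable D := (Set.to_countable D).to_subtype
  obtain ⟨e⟩ : Nonempty (ℕ ≃ D) := ⟨(nonempty_equiv_of_countable (α := ℕ) (β := D)).some⟩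
  have h1 : ∀ i, Φ (e i).1.1 (e i).1.2 = 1 := fun i => (hDdual _ (e i).2 _ (e i).2).1 rfl
  have h0 : ∀ i j, i ≠ j → Φ (e i).1.1 (e j).1.2 = 0 := fun i j hij =>
    (hDdual _ (e i).2 _ (e j).2).2 fun h => hij (e.injective (Subtype.ext h))
  have hr1 : Set.range (fun i => (e i).1.1) = Prod.fst '' D := by
    rw [Set.image_eq_range]
    exact e.surjective.range_comp (fun a : D => a.1.1)
  have hr2 : Set.range (fun i => (e i).1.2) = Prod.snd '' D := by
    rw [Set.image_eq_range]
    exact e.surjective.range_comp (fun a : D => a.1.2)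
  have li1 : LinearIndependent R (fun i => (e i).1.1) := LinearIndependent.of_dual h1 h0
  have li2 : LinearIndependent R (fun i => (e i).1.2) :=
    LinearIndependent.of_dual (Φ := Φ.flip) h1 fun i j hij => h0 j i hij.symm
  refine ⟨Module.Basis.mk li1 (by rw [hr1, hspan1]), Module.Basis.mk li2 (by rw [hr2, hspan2]),
    fun i j => ?_⟩
  rw [Module.Basis.mk_apply, Module.Basis.mk_apply]
  split_ifs with h
  · rw [h]; exact h1 j
  · exact h0 i j h

/-- A finite dual system with first components in `L` can be enlarged inside `L` until it spans `L`;
the finite rank of `L` stops the process. The second components then realise the coordinate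
functionals on `L`. -/
theorem SplitsLeft.isFinitelyCoveredLeft (hΦ : SplitsLeft Φ) : IsFinitelyCoveredLeft Φ := by
  intro L hL hrank f
  obtain ⟨s, hsf, hs, hsL, hLs⟩ : ∃ s : Set (M × N), s.Finite ∧ IsDualSystem Φ s ∧
      (∀ a ∈ s, a.1 ∈ L) ∧ L ≤ Submodule.span R (Prod.fst '' s) := by
    by_contra! hcon
    have hex : ∀ n : ℕ, ∃ s : Set (M × N), s.Finite ∧ s.ncard = n ∧ IsDualSystem Φ s ∧
        ∀ a ∈ s, a.1 ∈ L := by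
      intro n
      induction n with
      | zero => exact ⟨∅, Set.finite_empty, by simp, fun a ha => ha.elim, fun a ha => ha.elim⟩
      | succ n ih =>
        obtain ⟨s, hsf, hsn, hs, hsL⟩ := ih
        obtain ⟨x, hxL, hx⟩ := SetLike.not_le_iff_exists.1 (hcon s hsf hs hsL)
        obtain ⟨c, h, r, hnot, hd, hr, hxc⟩ := hs.exists_insert hsf hΦ hx
        have hspL : Submodule.span R (Prod.fst '' s) ≤ L := by
          rw [Submodule.span_le]
          rintro _ ⟨a, ha, rfl⟩
          exact hsL a ha
        have hrc : r • c ∈ L := by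
          rw [← sub_sub_cancel x (r • c)]
          exact L.sub_mem hxL (hspL hxc)
        -- Purity of `L` together with cancellation of `r` puts `c` itself in `L`.
        obtain ⟨m, hmL, hm⟩ := hL r c hrc
        refine ⟨insert (c, h) s, hsf.insert _, ?_, hd, ?_⟩
        · rw [Set.ncard_insert_of_notMem hnot hsf, hsn]
        · rintro a (rfl | ha)
          · exact hΦ.smul_left_cancel hr hm ▸ hmL
          · exact hsL a ha
    obtain ⟨k, hk⟩ := Cardinal.lt_aleph0.1 hrank
    obtain ⟨s, hsf, hsn, hs, hsL⟩ := hex (k + 1)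
    have hli : LinearIndependent R (fun a : s => (⟨a.1.1, hsL a a.2⟩ : L)) := by
      refine LinearIndependent.of_comp L.subtype ?_
      exact hs.linearIndependent
    have hle := hli.cardinal_le_rank
    rw [hk, ← Set.cast_ncard hsf, hsn] at hle
    exact absurd (Nat.cast_le.1 hle) (by omega)
  lift s to Finset (M × N) using hsf
  have hexp : ∀ x ∈ Submodule.span R (Prod.fst '' (s : Set (M × N))),
      x = ∑ a ∈ s, Φ x a.2 • a.1 := by
    intro x hx
    induction hx using Submodule.span_induction with
    | mem x hx =>
      obtain ⟨b, hb, rfl⟩ := hx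
      rw [Finset.sum_eq_single b]
      · rw [(hs b hb b hb).1 rfl, one_smul]
      · intro a ha hab
        rw [(hs b hb a ha).2 hab.symm, zero_smul]
      · exact fun h => (h hb).elim
    | zero => simp
    | add x y _ _ hx hy =>
      simp only [map_add, LinearMap.add_apply, add_smul, Finset.sum_add_distrib]
      rw [← hx, ← hy]
    | smul r x _ hx =>
      simp only [map_smul, LinearMap.smul_apply, smul_assoc, ← Finset.smul_sum]
      rw [← hx]
  refine ⟨∑ a ∈ s.attach, f ⟨a.1.1, hsL a.1 a.2⟩ • a.1.2, fun x => ?_⟩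
  have hx : x = ∑ a ∈ s.attach, Φ x a.1.2 • (⟨a.1.1, hsL a.1 a.2⟩ : L) := by
    apply Subtype.ext
    rw [AddSubmonoidClass.coe_finsetSum]
    simp only [Submodule.coe_smul]
    rw [Finset.sum_attach s (fun a => Φ x a.2 • a.1)]
    exact hexp x (hLs x.2)
  conv_rhs => rw [hx]
  simp only [map_sum, map_smul, _root_.smul_eq_mul]
  exact Finset.sum_congr rfl fun a _ => mul_comm _ _

/-- Write `g = r • c` with `Φ c h = 1`. Purity of a nonzero `g` makes `r` a unit, so `Φ g` takes a
unit value at `h`, and divisibility of a multiple of `Φ g` can be tested there. -/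
theorem SplitsLeft.isPureElement (hΦ : SplitsLeft Φ) {g : M} (hg : IsPureElement R g) :
    IsPureElement R (Φ g) := by
  by_cases hg0 : g = 0
  · subst hg0
    intro r ψ hψ
    refine ⟨0, zero_mem _, ?_⟩
    rw [map_zero, Submodule.span_zero_singleton, Submodule.mem_bot] at hψ
    rw [hψ, smul_zero]
  obtain ⟨r, c, h, hgc, hc⟩ := hΦ g hg0
  obtain ⟨n, hn, hrn⟩ := hg r c (by rw [← hgc]; exact Submodule.mem_span_singleton_self g)
  obtain ⟨t, rfl⟩ := Submodule.mem_span_singleton.1 hn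
  have hrt : t * r = 1 := by
    rw [← hgc] at hrn
    have h0 : (t * r - 1) • g = 0 := by
      rw [sub_smul, one_smul, mul_comm, mul_smul, hrn, _root_.sub_self]
    exact sub_eq_zero.1 ((hΦ.smul_eq_zero h0).resolve_right hg0)
  intro a ψ hψ
  obtain ⟨s, hs⟩ := Submodule.mem_span_singleton.1 hψ
  refine ⟨(ψ h * t) • Φ g, Submodule.smul_mem _ _ (Submodule.mem_span_singleton_self _), ?_⟩
  have h1 := congrArg (fun x => x h) hs
  simp only [LinearMap.smul_apply, _root_.smul_eq_mul] at h1
  have h2 : Φ g h = r := by rw [hgc, map_smul, LinearMap.smul_apply, hc, _root_.smul_eq_mul, mul_one]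
  rw [h2] at h1
  rw [smul_smul, ← hs]
  congr 1
  linear_combination s * hrt - t * h1

theorem isCountableForm_of_splits [Countable M] [Countable N] (hΦ : SplitsLeft Φ)
    (hΦ' : SplitsLeft Φ.flip) (hfin : ¬ Module.Finite R M) : IsCountableForm Φ := by
  obtain ⟨b, b', -⟩ := exists_dual_bases hΦ hΦ' hfin
  exact
  { free_left := Module.Free.of_basis b
    free_right := Module.Free.of_basis b'
    rank_left := (rank_le_card R M).trans (Cardinal.mk_le_aleph0)
    rank_right := (rank_le_card R N).trans (Cardinal.mk_le_aleph0)
    nondegenerate := ⟨hΦ.separatingLeft, LinearMap.flip_separatingLeft.1 hΦ'.separatingLeft⟩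
    pure_left := fun g hg => hΦ.isPureElement hg
    pure_right := fun h hh => hΦ'.isPureElement hh }

theorem isFinitelyCovered_of_splits (hΦ : SplitsLeft Φ) (hΦ' : SplitsLeft Φ.flip) :
    IsFinitelyCovered Φ :=
  ⟨hΦ.isFinitelyCoveredLeft, hΦ'.isFinitelyCoveredLeft⟩

end SplitForms

/-! ### The p-adic pairing on sequences and good pairs -/

section AdicPairing

variable {R : Type u} [CommRing R]

/-- The sum of the products `x i * z i` converges `p`-adically to `r`. -/
def PairsTo (p : R) (x z : ℕ → R) (r : R) : Prop :=
  ∀ k : ℕ, ∀ᶠ n in Filter.atTop, p ^ k ∣ ∑ i ∈ Finset.range n, x i * z i - r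

/-- The `p`-adic topology of the ring is separated. -/
def AdicSeparated (p : R) : Prop :=
  ∀ r : R, (∀ k : ℕ, p ^ k ∣ r) → r = 0

variable {p : R}

theorem PairsTo.symm {x z : ℕ → R} {r : R} (h : PairsTo p x z r) : PairsTo p z x r := by
  intro k
  simpa only [mul_comm (z _)] using h k

theorem PairsTo.add_left {x y z : ℕ → R} {r s : R} (hx : PairsTo p x z r)
    (hy : PairsTo p y z s) : PairsTo p (x + y) z (r + s) := by
  intro k
  filter_upwards [hx k, hy k] with n h1 h2
  have := dvd_add h1 h2
  simp only [Pi.add_apply, add_mul, Finset.sum_add_distrib]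
  convert this using 1
  ring

theorem PairsTo.smul_left {x z : ℕ → R} {r : R} (a : R) (hx : PairsTo p x z r) :
    PairsTo p (a • x) z (a * r) := by
  intro k
  filter_upwards [hx k] with n h1
  simp only [Pi.smul_apply, _root_.smul_eq_mul, mul_assoc, ← Finset.mul_sum]
  rw [← _root_.mul_sub]
  exact h1.mul_left a

theorem PairsTo.add_right {x y z : ℕ → R} {r s : R} (hx : PairsTo p z x r)
    (hy : PairsTo p z y s) : PairsTo p z (x + y) (r + s) :=
  (hx.symm.add_left hy.symm).symm

theorem PairsTo.smul_right {x z : ℕ → R} {r : R} (a : R) (hx : PairsTo p z x r) :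
    PairsTo p z (a • x) (a * r) :=
  (hx.symm.smul_left a).symm

theorem PairsTo.zero_left (z : ℕ → R) : PairsTo p 0 z 0 := by
  intro k
  simp

theorem PairsTo.sub_left {x y z : ℕ → R} {r s : R} (hx : PairsTo p x z r)
    (hy : PairsTo p y z s) : PairsTo p (x - y) z (r - s) := by
  simpa [sub_eq_add_neg] using hx.add_left (hy.smul_left (-1))

theorem PairsTo.sum_left {ι : Type*} (t : Finset ι) {x : ι → ℕ → R} {z : ℕ → R} {r : ι → R}
    (h : ∀ i ∈ t, PairsTo p (x i) z (r i)) : PairsTo p (∑ i ∈ t, x i) z (∑ i ∈ t, r i) := by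
  classical
  induction t using Finset.induction_on with
  | empty => simpa using PairsTo.zero_left z
  | insert a t ha ih =>
    rw [Finset.sum_insert ha, Finset.sum_insert ha]
    exact (h a (Finset.mem_insert_self a t)).add_left
      (ih fun i hi => h i (Finset.mem_insert_of_mem hi))

theorem PairsTo.unique (hp : AdicSeparated p) {x z : ℕ → R} {r s : R} (hr : PairsTo p x z r)
    (hs : PairsTo p x z s) : r = s := by
  refine sub_eq_zero.1 (hp _ fun k => ?_)
  obtain ⟨n, h1, h2⟩ := ((hr k).and (hs k)).exists
  have := dvd_sub h2 h1
  rwa [sub_sub_sub_cancel_left] at this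

theorem PairsTo.single_right (x : ℕ → R) (n : ℕ) : PairsTo p x (Pi.single n 1) (x n) := by
  intro k
  filter_upwards [Filter.eventually_gt_atTop n] with m hm
  rw [Finset.sum_eq_single n]
  · simp
  · intro i _ hi
    simp [hi]
  · intro h
    exact (h (Finset.mem_range.2 hm)).elim

/-- Uniform coordinatewise approximation modulo `p ^ k` allows the two limits to be interchanged;
this evaluates the pairing on infinite sums of sequences. -/
theorem PairsTo.of_approx {w z : ℕ → R} {r : R}
    (h : ∀ k : ℕ, ∃ (x : ℕ → R) (s : R), PairsTo p x z s ∧ (∀ i, p ^ k ∣ w i - x i) ∧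
      p ^ k ∣ r - s) : PairsTo p w z r := by
  intro k
  obtain ⟨x, s, hx, hw, hr⟩ := h k
  filter_upwards [hx k] with n hn
  have h1 : p ^ k ∣ ∑ i ∈ Finset.range n, (w i - x i) * z i :=
    Finset.dvd_sum fun i _ => (hw i).mul_right _
  have h2 := dvd_sub (dvd_add h1 hn) hr
  convert h2 using 1
  simp only [sub_mul, Finset.sum_sub_distrib]
  ring

open Classical in
/-- The `p`-adic sum of the products `x i * z i` if it converges in the ring, and `0` otherwise. -/
noncomputable def dot (p : R) (x z : ℕ → R) : R :=
  if h : ∃ r, PairsTo p x z r then h.choose else 0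

theorem PairsTo.dot_eq (hp : AdicSeparated p) {x z : ℕ → R} {r : R} (h : PairsTo p x z r) :
    dot p x z = r := by
  have hex : ∃ r, PairsTo p x z r := ⟨r, h⟩
  rw [dot, dif_pos hex]
  exact hex.choose_spec.unique hp h

/-- The `p`-adic sums of products are defined on the pair of submodules. -/
def HasPairing (p : R) (P : Submodule R (ℕ → R) × Submodule R (ℕ → R)) : Prop :=
  ∀ x ∈ P.1, ∀ z ∈ P.2, ∃ r, PairsTo p x z r

theorem HasPairing.pairsTo {P : Submodule R (ℕ → R) × Submodule R (ℕ → R)}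
    (hP : HasPairing p P) {x z : ℕ → R} (hx : x ∈ P.1) (hz : z ∈ P.2) :
    PairsTo p x z (dot p x z) := by
  have hex := hP x hx z hz
  rw [dot, dif_pos hex]
  exact hex.choose_spec

/-- The bilinear form given by the `p`-adic sums of products. -/
noncomputable def adicForm (hp : AdicSeparated p)
    {P : Submodule R (ℕ → R) × Submodule R (ℕ → R)} (hP : HasPairing p P) :
    P.1 →ₗ[R] P.2 →ₗ[R] R :=
  LinearMap.mk₂ R (fun x z => dot p x.1 z.1)
    (fun x y z => ((hP.pairsTo x.2 z.2).add_left (hP.pairsTo y.2 z.2)).dot_eq hp)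
    (fun a x z => ((hP.pairsTo x.2 z.2).smul_left a).dot_eq hp)
    (fun x y z => ((hP.pairsTo x.2 y.2).add_right (hP.pairsTo x.2 z.2)).dot_eq hp)
    (fun a x z => ((hP.pairsTo x.2 z.2).smul_right a).dot_eq hp)

/-- Pairs of countable submodules of `ℕ → R` containing the finitely supported sequences, on which
the `p`-adic sums of products are defined and split both sides. -/
structure GoodPair (p : R) (P : Submodule R (ℕ → R) × Submodule R (ℕ → R)) : Prop where
  countable_left : (P.1 : Set (ℕ → R)).Countable
  countable_right : (P.2 : Set (ℕ → R)).Countable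
  hasPairing : HasPairing p P
  splits_left : ∀ x ∈ P.1, x ≠ 0 → ∃ r : R, ∃ c ∈ P.1, ∃ h ∈ P.2, x = r • c ∧ PairsTo p c h 1
  splits_right : ∀ z ∈ P.2, z ≠ 0 → ∃ r : R, ∃ c ∈ P.2, ∃ h ∈ P.1, z = r • c ∧ PairsTo p c h 1
  single_left : ∀ n, Pi.single n 1 ∈ P.1
  single_right : ∀ n, Pi.single n 1 ∈ P.2

theorem HasPairing.swap {P : Submodule R (ℕ → R) × Submodule R (ℕ → R)} (hP : HasPairing p P) :
    HasPairing p P.swap := by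
  intro x hx z hz
  obtain ⟨r, hr⟩ := hP z hz x hx
  exact ⟨r, hr.symm⟩

theorem GoodPair.swap {P : Submodule R (ℕ → R) × Submodule R (ℕ → R)} (hP : GoodPair p P) :
    GoodPair p P.swap where
  countable_left := hP.countable_right
  countable_right := hP.countable_left
  hasPairing := hP.hasPairing.swap
  splits_left := hP.splits_right
  splits_right := hP.splits_left
  single_left := hP.single_right
  single_right := hP.single_left

/-- The pairing and splitting conditions concern finitely many elements at a time, so they are
inherited from a member of the directed family. Countability of the index keeps the union countable.
-/
theorem GoodPair.iSup {ι : Type*} [Countable ι] [Nonempty ι]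
    {P : ι → Submodule R (ℕ → R) × Submodule R (ℕ → R)} (hd : Directed (· ≤ ·) P)
    (hP : ∀ i, GoodPair p (P i)) : GoodPair p (⨆ i, P i) := by
  have hd1 : Directed (· ≤ ·) fun i => (P i).1 := fun i j =>
    let ⟨k, hi, hj⟩ := hd i j
    ⟨k, hi.1, hj.1⟩
  have hd2 : Directed (· ≤ ·) fun i => (P i).2 := fun i j =>
    let ⟨k, hi, hj⟩ := hd i j
    ⟨k, hi.2, hj.2⟩
  have m1 : ∀ x, x ∈ (⨆ i, P i).1 ↔ ∃ i, x ∈ (P i).1 := fun x => by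
    rw [Prod.fst_iSup, Submodule.mem_iSup_of_directed _ hd1]
  have m2 : ∀ x, x ∈ (⨆ i, P i).2 ↔ ∃ i, x ∈ (P i).2 := fun x => by
    rw [Prod.snd_iSup, Submodule.mem_iSup_of_directed _ hd2]
  refine ⟨?_, ?_, ?_, ?_, ?_, ?_, ?_⟩
  · refine (Set.countable_iUnion fun i => (hP i).countable_left).mono fun x hx => ?_
    exact Set.mem_iUnion.2 ((m1 x).1 hx)
  · refine (Set.countable_iUnion fun i => (hP i).countable_right).mono fun x hx => ?_
    exact Set.mem_iUnion.2 ((m2 x).1 hx)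
  · intro x hx z hz
    obtain ⟨i, hi⟩ := (m1 x).1 hx
    obtain ⟨j, hj⟩ := (m2 z).1 hz
    obtain ⟨k, hik, hjk⟩ := hd i j
    exact (hP k).hasPairing x (hik.1 hi) z (hjk.2 hj)
  · intro x hx hx0
    obtain ⟨i, hi⟩ := (m1 x).1 hx
    obtain ⟨r, c, hc, h, hh, h1⟩ := (hP i).splits_left x hi hx0
    exact ⟨r, c, (m1 c).2 ⟨i, hc⟩, h, (m2 h).2 ⟨i, hh⟩, h1⟩
  · intro x hx hx0
    obtain ⟨i, hi⟩ := (m2 x).1 hx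
    obtain ⟨r, c, hc, h, hh, h1⟩ := (hP i).splits_right x hi hx0
    exact ⟨r, c, (m2 c).2 ⟨i, hc⟩, h, (m1 h).2 ⟨i, hh⟩, h1⟩
  · exact fun n => (m1 _).2 ⟨Classical.arbitrary ι, (hP _).single_left n⟩
  · exact fun n => (m2 _).2 ⟨Classical.arbitrary ι, (hP _).single_right n⟩

/-- Elements that are dual, on the right, to a spanning sequence split the left side. -/
theorem exists_split_of_dual [IsDomain R] [IsPrincipalIdealRing R] (hp : AdicSeparated p)
    {P : Submodule R (ℕ → R) × Submodule R (ℕ → R)} (hP : HasPairing p P) {e f : ℕ → ℕ → R}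
    (he : P.1 = Submodule.span R (Set.range e)) (hf : ∀ n, f n ∈ P.2)
    (hef : ∀ i j, PairsTo p (e i) (f j) (if i = j then 1 else 0)) :
    ∀ x ∈ P.1, x ≠ 0 → ∃ r : R, ∃ c ∈ P.1, ∃ h ∈ P.2, x = r • c ∧ PairsTo p c h 1 := by
  intro x hx hx0
  set Φ := adicForm hp hP
  set X : P.1 := ⟨x, hx⟩
  -- The values of `x` on the right side form a principal ideal. Its generator `r` is one of these
  -- values and divides every coefficient of `x`, since the coefficients are the values at the `f
  -- j`; dividing by `r` gives `c`.
  obtain ⟨r, hr⟩ := (IsPrincipalIdealRing.principal (LinearMap.range (Φ X))).principal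
  have hr' : r ∈ LinearMap.range (Φ X) := hr ▸ Submodule.mem_span_singleton_self r
  obtain ⟨h, hh⟩ := hr'
  have hdiv : ∀ z : P.2, ∃ t, dot p x z = r * t := by
    intro z
    have : Φ X z ∈ LinearMap.range (Φ X) := ⟨z, rfl⟩
    rw [hr] at this
    obtain ⟨t, ht⟩ := Submodule.mem_span_singleton.1 this
    exact ⟨t, by rw [mul_comm]; exact ht.symm⟩
  have hx' := hx
  rw [he, Finsupp.mem_span_range_iff_exists_finsupp] at hx'
  obtain ⟨a, ha⟩ := hx'
  have hcoef : ∀ j, dot p x (f j) = a j := by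
    intro j
    have h1 : PairsTo p x (f j) (∑ i ∈ a.support, a i * if i = j then 1 else 0) := by
      rw [← ha]
      exact PairsTo.sum_left _ fun i _ => (hef i j).smul_left (a i)
    rw [h1.dot_eq hp]
    simp only [mul_ite, mul_one, mul_zero, Finset.sum_ite_eq', Finsupp.mem_support_iff]
    split_ifs with h
    · rfl
    · exact (Finsupp.notMem_support_iff.1 h).symm
  choose t ht using fun j => hdiv ⟨f j, hf j⟩
  set c : ℕ → R := ∑ i ∈ a.support, t i • e i with hc
  have hcP : c ∈ P.1 := by
    rw [he]
    exact Submodule.sum_mem _ fun i _ =>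
      Submodule.smul_mem _ _ (Submodule.subset_span ⟨i, rfl⟩)
  have hxc : x = r • c := by
    rw [← ha, hc, Finset.smul_sum, Finsupp.sum]
    refine Finset.sum_congr rfl fun i _ => ?_
    rw [smul_smul, ← ht i, hcoef i]
  have hr0 : r ≠ 0 := by
    rintro rfl
    exact hx0 (by rw [hxc, zero_smul])
  have h1 := hP.pairsTo hcP h.2
  have h2 : r * dot p c h = r * 1 := by
    rw [mul_one, ← (h1.smul_left r).dot_eq hp, ← hxc]
    exact hh
  rw [mul_left_cancel₀ hr0 h2] at h1
  exact ⟨r, c, hcP, h.1, h.2, hxc, h1⟩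

/-- The pair of modules of finitely supported sequences. -/
def singlePair (R : Type u) [CommRing R] : Submodule R (ℕ → R) × Submodule R (ℕ → R) :=
  (Submodule.span R (Set.range fun n => Pi.single n 1),
    Submodule.span R (Set.range fun n => Pi.single n 1))

theorem pairsTo_single (i j : ℕ) :
    PairsTo p (Pi.single i 1) (Pi.single j 1) (if i = j then 1 else 0) := by
  have := PairsTo.single_right (p := p) (Pi.single i (1 : R)) j
  rwa [Pi.single_apply, if_congr eq_comm rfl rfl] at this

theorem countable_span_range [Countable R] {M : Type*} [AddCommGroup M] [Module R M]
    (e : ℕ → M) : (Submodule.span R (Set.range e) : Set M).Countable := by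
  have : (Submodule.span R (Set.range e) : Set M) =
      Set.range fun a : ℕ →₀ R => a.sum fun i r => r • e i := by
    ext x
    rw [SetLike.mem_coe, Finsupp.mem_span_range_iff_exists_finsupp]
    rfl
  rw [this]
  exact Set.countable_range _

theorem goodPair_singlePair [IsDomain R] [IsPrincipalIdealRing R] [Countable R]
    (hp : AdicSeparated p) : GoodPair p (singlePair R) := by
  have hpair : HasPairing p (singlePair R) := by
    intro x hx z hz
    induction hz using Submodule.span_induction with
    | mem z hz =>
      obtain ⟨n, rfl⟩ := hz
      exact ⟨_, PairsTo.single_right x n⟩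
    | zero => exact ⟨0, (PairsTo.zero_left x).symm⟩
    | add y z _ _ hy hz =>
      obtain ⟨r, hr⟩ := hy
      obtain ⟨s, hs⟩ := hz
      exact ⟨_, hr.add_right hs⟩
    | smul a z _ hz =>
      obtain ⟨r, hr⟩ := hz
      exact ⟨_, hr.smul_right a⟩
  have hs : ∀ n : ℕ, (Pi.single n 1 : ℕ → R) ∈
      Submodule.span R (Set.range fun n : ℕ => (Pi.single n 1 : ℕ → R)) :=
    fun n => Submodule.subset_span ⟨n, rfl⟩
  have hsplit := exists_split_of_dual hp hpair rfl hs pairsTo_single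
  exact ⟨countable_span_range _, countable_span_range _, hpair, hsplit, hsplit, hs, hs⟩

section Restriction

variable {P Q : Submodule R (ℕ → R) × Submodule R (ℕ → R)}

theorem GoodPair.splitsLeft_restrict (hp : AdicSeparated p) (hP : GoodPair p P)
    (hQ : HasPairing p Q) (hPQ : P ≤ Q) :
    SplitsLeft (R := R) (M := P.1.submoduleOf Q.1) (N := P.2.submoduleOf Q.2)
      ((adicForm hp hQ).domRestrict₁₂ (P.1.submoduleOf Q.1) (P.2.submoduleOf Q.2)) := by
  rintro ⟨⟨x, hxQ⟩, hx⟩ hx0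
  obtain ⟨r, c, hc, h, hh, hxc, h1⟩ := hP.splits_left x hx fun h => hx0 (by subst h; rfl)
  exact ⟨r, ⟨⟨c, hPQ.1 hc⟩, hc⟩, ⟨⟨h, hPQ.2 hh⟩, hh⟩, Subtype.ext (Subtype.ext hxc),
    h1.dot_eq hp⟩

theorem GoodPair.splitsLeft_restrict_flip (hp : AdicSeparated p) (hP : GoodPair p P)
    (hQ : HasPairing p Q) (hPQ : P ≤ Q) :
    SplitsLeft (R := R) (M := P.2.submoduleOf Q.2) (N := P.1.submoduleOf Q.1)
      ((adicForm hp hQ).domRestrict₁₂ (P.1.submoduleOf Q.1) (P.2.submoduleOf Q.2)).flip := by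
  rintro ⟨⟨x, hxQ⟩, hx⟩ hx0
  obtain ⟨r, c, hc, h, hh, hxc, h1⟩ := hP.splits_right x hx fun h => hx0 (by subst h; rfl)
  exact ⟨r, ⟨⟨c, hPQ.2 hc⟩, hc⟩, ⟨⟨h, hPQ.1 hh⟩, hh⟩, Subtype.ext (Subtype.ext hxc),
    h1.symm.dot_eq hp⟩

theorem GoodPair.not_finite_restrict [Nontrivial R] (hp : AdicSeparated p) (hP : GoodPair p P)
    (hQ : HasPairing p Q) (hPQ : P ≤ Q) : ¬ Module.Finite R (P.1.submoduleOf Q.1) := by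
  refine not_finite_of_dual (R := R) (M := P.1.submoduleOf Q.1) (N := P.2.submoduleOf Q.2)
    (Φ := (adicForm hp hQ).domRestrict₁₂ (P.1.submoduleOf Q.1) (P.2.submoduleOf Q.2))
    (e := fun n => ⟨⟨Pi.single n 1, hPQ.1 (hP.single_left n)⟩, hP.single_left n⟩)
    (f := fun n => ⟨⟨Pi.single n 1, hPQ.2 (hP.single_right n)⟩, hP.single_right n⟩) ?_ ?_
  · intro i
    refine ((pairsTo_single (p := p) i i).dot_eq hp).trans (if_pos rfl)
  · intro i j hij
    refine ((pairsTo_single (p := p) i j).dot_eq hp).trans (if_neg hij)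

theorem GoodPair.countable_restrict_left (hP : GoodPair p P) :
    Countable (P.1.submoduleOf Q.1) := by
  have := hP.countable_left.to_subtype
  exact Function.Injective.countable (f := fun x : P.1.submoduleOf Q.1 => (⟨x.1.1, x.2⟩ : P.1))
    fun x y h => Subtype.ext (Subtype.ext (congrArg (fun y : P.1 => y.1) h))

theorem GoodPair.countable_restrict_right (hP : GoodPair p P) :
    Countable (P.2.submoduleOf Q.2) :=
  hP.swap.countable_restrict_left (Q := Q.swap)

theorem GoodPair.isCountableForm [IsDomain R] (hp : AdicSeparated p) (hP : GoodPair p P)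
    (hQ : HasPairing p Q) (hPQ : P ≤ Q) : IsCountableForm (R := R) (G := P.1.submoduleOf Q.1) (H := P.2.submoduleOf Q.2)
      ((adicForm hp hQ).domRestrict₁₂ (P.1.submoduleOf Q.1) (P.2.submoduleOf Q.2)) :=
  have := hP.countable_restrict_left (Q := Q)
  have := hP.countable_restrict_right (Q := Q)
  isCountableForm_of_splits (hP.splitsLeft_restrict hp hQ hPQ)
    (hP.splitsLeft_restrict_flip hp hQ hPQ) (hP.not_finite_restrict hp hQ hPQ)

theorem GoodPair.isFinitelyCovered [IsDomain R] (hp : AdicSeparated p) (hP : GoodPair p P)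
    (hQ : HasPairing p Q) (hPQ : P ≤ Q) : IsFinitelyCovered (R := R) (G := P.1.submoduleOf Q.1) (H := P.2.submoduleOf Q.2)
      ((adicForm hp hQ).domRestrict₁₂ (P.1.submoduleOf Q.1) (P.2.submoduleOf Q.2)) :=
  isFinitelyCovered_of_splits (hP.splitsLeft_restrict hp hQ hPQ)
    (hP.splitsLeft_restrict_flip hp hQ hPQ)

theorem GoodPair.exists_dual_bases [IsDomain R] (hp : AdicSeparated p) (hP : GoodPair p P) :
    ∃ (b : Module.Basis ℕ R P.1) (b' : Module.Basis ℕ R P.2),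
      ∀ i j, PairsTo p (b i).1 (b' j).1 (if i = j then 1 else 0) := by
  have := hP.countable_restrict_left (Q := P)
  have := hP.countable_restrict_right (Q := P)
  obtain ⟨b, b', hb⟩ := _root_.exists_dual_bases
    (hP.splitsLeft_restrict hp hP.hasPairing le_rfl)
    (hP.splitsLeft_restrict_flip hp hP.hasPairing le_rfl)
    (hP.not_finite_restrict hp hP.hasPairing le_rfl)
  refine ⟨b.map (Submodule.submoduleOfEquivOfLe le_rfl),
    b'.map (Submodule.submoduleOfEquivOfLe le_rfl), fun i j => ?_⟩
  rw [← hb i j]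
  exact hP.hasPairing.pairsTo (b i).2 (b' j).2

theorem span_range_coe_basis {ι : Type*} {N : Submodule R (ℕ → R)} (b : Module.Basis ι R N) :
    Submodule.span R (Set.range fun n => (b n).1) = N := by
  have h1 := congrArg (Submodule.map N.subtype) b.span_eq
  rwa [Submodule.map_span, ← Set.range_comp, Submodule.map_top, Submodule.range_subtype] at h1

/-- If `r • m = s • c` with `c` pairing to `1` with `h`, then `s` is `r` times the pairing of `m`
and `h`. That pairing lies in `R` even when `m` is only in the larger module, so `r • m` is `r`
times a multiple of `c`. -/
theorem GoodPair.isPureSubmodule [IsDomain R] (hp : AdicSeparated p) (hP : GoodPair p P)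
    (hQ : HasPairing p Q) (hPQ : P ≤ Q) : IsPureSubmodule (P.1.submoduleOf Q.1) := by
  rintro r ⟨m, hm⟩ hrm
  have hrm' : r • m ∈ P.1 := hrm
  by_cases h0 : r • m = 0
  · refine ⟨0, zero_mem _, Subtype.ext ?_⟩
    simpa using h0.symm
  obtain ⟨s, c, hc, h, hh, hsc, h1⟩ := hP.splits_left _ hrm' h0
  have h2 : r * dot p m h = s := by
    rw [← ((hQ.pairsTo hm (hPQ.2 hh)).smul_left r).dot_eq hp, hsc, (h1.smul_left s).dot_eq hp,
      mul_one]
  refine ⟨⟨dot p m h • c, hPQ.1 (P.1.smul_mem _ hc)⟩, P.1.smul_mem _ hc, Subtype.ext ?_⟩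
  change r • dot p m h • c = r • m
  rw [smul_smul, h2, hsc]

end Restriction

end AdicPairing

/-! ### A Baire category argument and a criterion for torsion cokernel -/

section AvoidingSequences

variable {R : Type u} [CommRing R] [IsDomain R] {p : R}

/-- The strictly increasing sequence with increments `d i + 1`. -/
def partialSums (d : ℕ → ℕ) (n : ℕ) : ℕ :=
  ∑ i ∈ Finset.range n, (d i + 1)

theorem partialSums_succ (d : ℕ → ℕ) (n : ℕ) :
    partialSums d (n + 1) = partialSums d n + (d n + 1) :=
  Finset.sum_range_succ _ _

theorem partialSums_strictMono (d : ℕ → ℕ) : StrictMono (partialSums d) :=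
  strictMono_nat_of_lt_succ fun n => by
    rw [partialSums_succ]
    omega

theorem partialSums_congr {d d' : ℕ → ℕ} {n : ℕ} (h : ∀ i < n, d i = d' i) :
    partialSums d n = partialSums d' n :=
  Finset.sum_congr rfl fun i hi => by rw [h i (Finset.mem_range.1 hi)]

/-- For countably many sequences with infinitely many nonzero terms, there are exponents `k` such
that no target is, for all `n`, modulo `p ^ k n` the `n`-th partial sum of the series with
coefficients `p ^ k j`. -/
theorem exists_strictMono_avoiding {B ι : Type*} [AddCommGroup B] [Module R B]
    [Module.IsTorsionFree R B] [Countable ι] (hp0 : p ≠ 0) (hp1 : ¬ IsUnit p)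
    (hB : ∀ v : B, v ≠ 0 → ∃ k : ℕ, ∀ w : B, v ≠ p ^ k • w)
    (t : ι → ℕ → B) (b : ι → B) (ht : ∀ i N, ∃ n ≥ N, t i n ≠ 0) :
    ∃ k : ℕ → ℕ, StrictMono k ∧ k 0 = 0 ∧
      ∀ i, ∃ n, ∀ w : B, ∑ j ∈ Finset.range n, p ^ k j • t i j - b i ≠ p ^ k n • w := by
  -- Exponent sequences are parametrised by arbitrary increments, so that Baire category applies to
  -- the whole product space `ℕ → ℕ`. Avoiding target `i` is seen at a finite stage, hence open.
  set U : ι → Set (ℕ → ℕ) := fun i => {d | ∃ n, ∀ w : B,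
    ∑ j ∈ Finset.range n, p ^ partialSums d j • t i j - b i ≠ p ^ partialSums d n • w} with hU
  have hopen : ∀ i, IsOpen (U i) := by
    intro i
    rw [isOpen_iff_forall_mem_open]
    rintro d ⟨n, hn⟩
    refine ⟨⋂ j ∈ Finset.range n, (fun d' : ℕ → ℕ => d' j) ⁻¹' {d j}, ?_, ?_, ?_⟩
    · intro d' hd'
      simp only [Set.mem_iInter, Set.mem_preimage, Set.mem_singleton_iff, Finset.mem_range] at hd'
      refine ⟨n, fun w => ?_⟩
      rw [partialSums_congr hd', Finset.sum_congr rfl fun j hj => by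
        rw [partialSums_congr fun i hi => hd' i (hi.trans (Finset.mem_range.1 hj))]]
      exact hn w
    · exact isOpen_biInter_finset fun j _ => (isOpen_discrete _).preimage (continuous_apply j)
    · simp
  have hext : ∀ i (d : ℕ → ℕ) N, ∃ d' ∈ U i, ∀ j < N, d' j = d j := by
    intro i d N
    obtain ⟨m, hm, htm⟩ := ht i (N + 1)
    -- Raising one increment changes only the last summand, by the factor `p`. As `1 - p ≠ 0` and
    -- the last term is nonzero, the two sums cannot both hit the target.
    obtain ⟨d₁, hd₁, hne⟩ : ∃ d₁ : ℕ → ℕ, (∀ j < N, d₁ j = d j) ∧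
        ∑ j ∈ Finset.range (m + 1), p ^ partialSums d₁ j • t i j - b i ≠ 0 := by
      by_contra! hcon
      obtain ⟨m, rfl⟩ : ∃ m', m = m' + 1 := ⟨m - 1, by omega⟩
      set d₂ := Function.update d m (d m + 1) with hd₂
      have hlt : ∀ j < m, d₂ j = d j := fun j hj => by
        rw [hd₂, Function.update_of_ne (by omega)]
      have h1 := hcon d fun _ _ => rfl
      have h2 := hcon d₂ fun j hj => hlt j (by omega)
      have h3 : partialSums d₂ (m + 1) = partialSums d (m + 1) + 1 := by
        have := partialSums_congr hlt
        rw [partialSums_succ, partialSums_succ, this, hd₂, Function.update_self]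
        omega
      rw [Finset.sum_range_succ] at h1 h2
      rw [Finset.sum_congr rfl fun j hj => by
        rw [partialSums_congr fun i hi => hlt i (by have := Finset.mem_range.1 hj; omega)],
        h3] at h2
      have h4 : (p ^ partialSums d (m + 1) * (1 - p)) • t i (m + 1) = 0 := by
        have := h1.trans h2.symm
        rw [sub_left_inj, add_right_inj] at this
        rw [_root_.mul_sub, mul_one, ← pow_succ, sub_smul, this, _root_.sub_self]
      rcases smul_eq_zero.1 h4 with h | h
      · rcases _root_.mul_eq_zero.1 h with h | h
        · exact pow_ne_zero _ hp0 h
        · exact hp1 (by rw [← sub_eq_zero.1 h]; exact isUnit_one)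
      · exact htm h
    -- The increment at position `m` does not enter the first `m + 1` exponents, so it can be taken
    -- large enough for the nonzero difference not to be divisible by the next power of `p`.
    obtain ⟨K, hK⟩ := hB _ hne
    refine ⟨Function.update d₁ m K, ⟨m + 1, fun w hw => ?_⟩, fun j hj => ?_⟩
    · have hlt : ∀ j < m, Function.update d₁ m K j = d₁ j := fun j hj => by
        rw [Function.update_of_ne (by omega)]
      have h3 : partialSums (Function.update d₁ m K) (m + 1) = partialSums d₁ m + 1 + K := by
        have := partialSums_congr hlt
        rw [partialSums_succ, this, Function.update_self]
        omega
      rw [Finset.sum_congr rfl fun j hj => by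
        rw [partialSums_congr fun i hi => hlt i (by have := Finset.mem_range.1 hj; omega)],
        h3, pow_add, mul_comm, mul_smul] at hw
      exact hK _ hw
    · rw [Function.update_of_ne (by omega), hd₁ j hj]
  have hdense : ∀ i, Dense (U i) := by
    intro i
    rw [dense_iff_inter_open]
    rintro V hV ⟨d, hd⟩
    obtain ⟨I, u, hu, hIV⟩ := isOpen_pi_iff.1 hV d hd
    obtain ⟨d', hd', hdd'⟩ := hext i d (I.sup id + 1)
    refine ⟨d', hIV fun j hj => ?_, hd'⟩
    rw [hdd' j (Nat.lt_succ_of_le (Finset.le_sup (f := id) hj))]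
    exact (hu j hj).2
  obtain ⟨d, hd⟩ := (dense_iInter_of_isOpen hopen hdense).nonempty
  exact ⟨partialSums d, partialSums_strictMono d, rfl, fun i => Set.mem_iInter.1 hd i⟩

/-- If an injective endomorphism is a scalar on cofinitely many basis elements, up to
denominators, then its cokernel is a torsion module. -/
theorem exists_smul_mem_range_of_eventually_scalar {M : Type*} [AddCommGroup M] [Module R M]
    [Module.IsTorsionFree R M] (b : Module.Basis ℕ R M) (η : M →ₗ[R] M)
    (hη : Function.Injective η) {s r : R} (hs : s ≠ 0) (N : ℕ)
    (h : ∀ n ≥ N, s • η (b n) = r • b n) (g : M) : ∃ c : R, c ≠ 0 ∧ c • g ∈ LinearMap.range η := by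
  -- Truncation to the first `N` coordinates; on its kernel `s • η` is multiplication by `r`.
  set π : M →ₗ[R] (Fin N → R) := LinearMap.pi fun i => b.coord i with hπ
  have hr : r ≠ 0 := by
    rintro rfl
    have h1 := h N le_rfl
    rw [zero_smul] at h1
    have h2 := (smul_eq_zero.1 h1).resolve_left hs
    exact b.ne_zero N (hη (by rw [h2, map_zero]))
  have hker : ∀ q, π q = 0 → s • η q = r • q := by
    intro q hq
    have h0 : ∀ n < N, b.repr q n = 0 := fun n hn => congrFun hq ⟨n, hn⟩
    have h1 : (s • η - r • LinearMap.id : M →ₗ[R] M) q = 0 := by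
      rw [← b.linearCombination_repr q, Finsupp.linearCombination_apply, Finsupp.sum, map_sum]
      refine Finset.sum_eq_zero fun n _ => ?_
      rw [map_smul]
      rcases lt_or_ge n N with hn | hn
      · rw [h0 n hn, zero_smul]
      · simp [h n hn]
    exact sub_eq_zero.1 h1
  have hinj : ∀ x, π (η x) = 0 → π x = 0 := by
    intro x hx
    have h1 : η (s • η x) = η (r • x) := by rw [map_smul, map_smul, hker _ hx]
    have h2 : r • π x = 0 := by rw [← map_smul, ← hη h1, map_smul, hx, smul_zero]
    exact (smul_eq_zero.1 h2).resolve_left hr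
  -- These are `N + 1` vectors in a free module of rank `N`. A relation puts `c none • g + η x` into
  -- the kernel of `π`, where multiplication by `r` lands in the range of `η`; `hinj` excludes `c
  -- none = 0`.
  have hdep : ¬ LinearIndependent R
      (fun o : Option (Fin N) => o.elim (π g) fun i => π (η (b i))) := by
    intro hli
    have := hli.fintype_card_le_finrank
    simp at this
  rw [Fintype.not_linearIndependent_iff] at hdep
  obtain ⟨c, hc, i, hi⟩ := hdep
  rw [Fintype.sum_option] at hc
  set x : M := ∑ i : Fin N, c (some i) • b i with hx
  have hx' : π (c none • g + η x) = 0 := by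
    rw [← hc, map_add, map_smul, hx]
    simp
  have h1 := hker _ hx'
  refine ⟨r * c none, ?_, s • (c none • g + η x) - r • x, ?_⟩
  · refine mul_ne_zero hr fun h0 => ?_
    rw [h0, zero_smul, zero_add] at hx'
    have h2 := hinj x hx'
    cases i with
    | none => exact hi h0
    | some i =>
      refine hi ?_
      have h3 := congrFun h2 i
      rw [hx] at h3
      simpa [hπ, Module.Basis.repr_self, Finsupp.single_apply, Fin.val_inj] using h3
  · rw [map_sub, map_smul, h1, map_smul, smul_add, mul_smul, add_sub_cancel_right]

end AvoidingSequences

/-! ### Adjoining a p-adic sum to one side -/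

section Extension

variable {R : Type u} [CommRing R] {p : R}
variable {P : Submodule R (ℕ → R) × Submodule R (ℕ → R)}

theorem PairsTo.eventually_zero {e f : ℕ → ℕ → R}
    (hef : ∀ i j, PairsTo p (e i) (f j) (if i = j then 1 else 0)) {z : ℕ → R}
    (hz : z ∈ Submodule.span R (Set.range f)) : ∃ B, ∀ n ≥ B, PairsTo p (e n) z 0 := by
  induction hz using Submodule.span_induction with
  | mem z hz =>
    obtain ⟨j, rfl⟩ := hz
    refine ⟨j + 1, fun n hn => ?_⟩
    have := hef n j
    rwa [if_neg (by omega)] at this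
  | zero => exact ⟨0, fun n _ => (PairsTo.zero_left _).symm⟩
  | add x y _ _ hx hy =>
    obtain ⟨B, hB⟩ := hx
    obtain ⟨B', hB'⟩ := hy
    refine ⟨max B B', fun n hn => ?_⟩
    simpa using (hB n ((le_max_left _ _).trans hn)).add_right
      (hB' n ((le_max_right _ _).trans hn))
  | smul a x _ hx =>
    obtain ⟨B, hB⟩ := hx
    exact ⟨B, fun n hn => by simpa using (hB n hn).smul_right a⟩

/-- The left part of a good pair with dual sequences `e` and `f` can be enlarged by the elements
`y n = ∑ j ≥ n, p ^ (k j - k n) • e j`. -/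
theorem GoodPair.exists_extension [IsDomain R] [IsPrincipalIdealRing R] [Countable R]
    (hp : AdicSeparated p) (hP : GoodPair p P) {e f : ℕ → ℕ → R}
    (he : Submodule.span R (Set.range e) = P.1) (hf : Submodule.span R (Set.range f) = P.2)
    (hef : ∀ i j, PairsTo p (e i) (f j) (if i = j then 1 else 0))
    {k : ℕ → ℕ} (hk : StrictMono k) (hk0 : k 0 = 0) :
    ∃ y : ℕ → ℕ → R, GoodPair p (Submodule.span R (Set.range y), P.2) ∧
      P.1 ≤ Submodule.span R (Set.range y) ∧
      ∀ n, y 0 = ∑ j ∈ Finset.range n, p ^ k j • e j + p ^ k n • y n := by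
  have heP : ∀ n, e n ∈ P.1 := fun n => he ▸ Submodule.subset_span ⟨n, rfl⟩
  have hfP : ∀ n, f n ∈ P.2 := fun n => hf ▸ Submodule.subset_span ⟨n, rfl⟩
  have hev : ∀ z ∈ P.2, ∃ B, ∀ n ≥ B, PairsTo p (e n) z 0 := fun z hz =>
    PairsTo.eventually_zero hef (hf ▸ hz)
  have hev' : ∀ i, ∃ B, ∀ n ≥ B, e n i = 0 := by
    intro i
    obtain ⟨B, hB⟩ := hev _ (hP.single_right i)
    exact ⟨B, fun n hn => (PairsTo.single_right (e n) i).unique hp (hB n hn)⟩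
  choose B hB using hev'
  -- Formally `y N` is the sum of `p ^ (k n - k N) • e n` over `n ≥ N`. Each coordinate is a finite
  -- sum because pairing with a unit sequence annihilates almost all `e n`.
  set y : ℕ → ℕ → R := fun N i => ∑ n ∈ Finset.Ico N (B i), p ^ (k n - k N) * e n i with hy
  have hIco : ∀ (a : ℕ → R) (N B M : ℕ), (∀ n ≥ B, a n = 0) → B ≤ M →
      ∑ n ∈ Finset.Ico N B, a n = ∑ n ∈ Finset.Ico N M, a n := by
    intro a N B M ha hBM
    refine Finset.sum_subset (Finset.Ico_subset_Ico_right hBM) fun n h1 h2 => ha n ?_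
    simp only [Finset.mem_Ico] at h1 h2
    omega
  have hyM : ∀ N M i, B i ≤ M → y N i = ∑ n ∈ Finset.Ico N M, p ^ (k n - k N) * e n i :=
    fun N M i hM => hIco _ _ _ _ (fun n hn => by rw [hB i n hn, mul_zero]) hM
  have hpair : ∀ z ∈ P.2, ∀ b, (∀ n ≥ b, PairsTo p (e n) z 0) → ∀ N,
      PairsTo p (y N) z (∑ n ∈ Finset.Ico N b, p ^ (k n - k N) * dot p (e n) z) := by
    intro z hz b hb N
    refine PairsTo.of_approx fun l => ?_
    set M := max b (N + l) with hM
    refine ⟨∑ n ∈ Finset.Ico N M, p ^ (k n - k N) • e n,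
      ∑ n ∈ Finset.Ico N M, p ^ (k n - k N) * dot p (e n) z, ?_, ?_, ?_⟩
    · exact PairsTo.sum_left _ fun n _ => (hP.hasPairing.pairsTo (heP n) hz).smul_left _
    · intro i
      rw [hyM N (max M (B i)) i (le_max_right _ _), Finset.sum_apply,
        ← Finset.sum_Ico_consecutive _ (show N ≤ M by omega) (le_max_left M (B i))]
      simp only [Pi.smul_apply, _root_.smul_eq_mul, add_sub_cancel_left]
      refine Finset.dvd_sum fun n hn => Dvd.dvd.mul_right (pow_dvd_pow p ?_) _
      have h1 := (Finset.mem_Ico.1 hn).1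
      have h2 : ∀ j, k N + j ≤ k (N + j) := by
        intro j
        induction j with
        | zero => simp
        | succ j ih =>
          have := hk (show N + j < N + (j + 1) by omega)
          omega
      have h3 := h2 l
      have h4 := hk.monotone (show N + l ≤ n by omega)
      omega
    · rw [hIco _ N b M (fun n hn => by rw [(hb n hn).dot_eq hp, mul_zero]) (le_max_left _ _),
        _root_.sub_self]
      exact dvd_zero _
  have hrec : ∀ N, y N = e N + p ^ (k (N + 1) - k N) • y (N + 1) := by
    intro N
    funext i
    have h1 : N < max (B i) (N + 1) := by omega
    rw [Pi.add_apply, Pi.smul_apply, hyM N _ i (le_max_left _ (N + 1)),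
      hyM (N + 1) _ i (le_max_left _ (N + 1)), Finset.sum_eq_sum_Ico_succ_bot h1,
      Nat.sub_self, pow_zero, one_mul, _root_.smul_eq_mul, Finset.mul_sum]
    congr 1
    refine Finset.sum_congr rfl fun n hn => ?_
    have h2 := hk (show N < N + 1 by omega)
    have h3 := hk.monotone (Finset.mem_Ico.1 hn).1
    rw [← mul_assoc, ← pow_add]
    congr 2
    omega
  have hyf : ∀ M N, PairsTo p (y M) (f N) (if M ≤ N then p ^ (k N - k M) else 0) := by
    intro M N
    have h1 : ∀ n ≥ N + 1, PairsTo p (e n) (f N) 0 := fun n hn => by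
      have := hef n N
      rwa [if_neg (by omega)] at this
    have h2 := hpair (f N) (hfP N) (N + 1) h1 M
    convert h2 using 1
    simp only [(hef _ N).dot_eq hp, mul_ite, mul_one, mul_zero, Finset.sum_ite_eq',
      Finset.mem_Ico, Nat.lt_succ_self, and_true]
  -- The `y M` pair with the `f N` in a unitriangular matrix; subtracting a multiple of the
  -- preceding `f` turns it into the identity. The right side is thus unchanged and contains a dual
  -- system to `y`.
  set f' : ℕ → ℕ → R := fun N => f N - (if N = 0 then 0 else p ^ (k N - k (N - 1))) • f (N - 1)
    with hf'
  have hf'P : ∀ N, f' N ∈ P.2 := fun N =>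
    Submodule.sub_mem _ (hfP N) (Submodule.smul_mem _ _ (hfP _))
  have hyf' : ∀ M N, PairsTo p (y M) (f' N) (if M = N then 1 else 0) := by
    intro M N
    have h1 := ((hyf M N).symm.sub_left
      ((hyf M (N - 1)).symm.smul_left (if N = 0 then 0 else p ^ (k N - k (N - 1))))).symm
    convert h1 using 1
    rcases N with _ | N
    · by_cases hM : M = 0 <;> simp [hM]
    · simp only [Nat.add_sub_cancel, Nat.succ_ne_zero, if_false]
      rcases lt_trichotomy M (N + 1) with h | h | h
      · have h2 := hk.monotone (show M ≤ N by omega)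
        have h3 := hk (show N < N + 1 by omega)
        rw [if_neg (by omega), if_pos (by omega), if_pos (by omega), ← pow_add,
          show k (N + 1) - k N + (k N - k M) = k (N + 1) - k M by omega, _root_.sub_self]
      · rw [if_pos h, if_pos (by omega), if_neg (by omega), h]
        simp
      · rw [if_neg (by omega), if_neg (by omega), if_neg (by omega)]
        simp
  have hyspan : ∀ n, y n ∈ Submodule.span R (Set.range y) := fun n =>
    Submodule.subset_span ⟨n, rfl⟩
  have hle : P.1 ≤ Submodule.span R (Set.range y) := by
    rw [← he, Submodule.span_le]
    rintro _ ⟨N, rfl⟩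
    rw [SetLike.mem_coe, ← add_sub_cancel_right (e N) (p ^ (k (N + 1) - k N) • y (N + 1)), ← hrec]
    exact Submodule.sub_mem _ (hyspan _) (Submodule.smul_mem _ _ (hyspan _))
  have hpairing : HasPairing p (Submodule.span R (Set.range y), P.2) := by
    intro x hx z hz
    induction hx using Submodule.span_induction with
    | mem x hx =>
      obtain ⟨N, rfl⟩ := hx
      obtain ⟨b, hb⟩ := hev z hz
      exact ⟨_, hpair z hz b hb N⟩
    | zero => exact ⟨0, PairsTo.zero_left z⟩
    | add x x' _ _ hx hx' =>
      obtain ⟨r, hr⟩ := hx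
      obtain ⟨s, hs⟩ := hx'
      exact ⟨_, hr.add_left hs⟩
    | smul a x _ hx =>
      obtain ⟨r, hr⟩ := hx
      exact ⟨_, hr.smul_left a⟩
  refine ⟨y, ⟨countable_span_range y, hP.countable_right, hpairing,
    exists_split_of_dual hp hpairing rfl hf'P hyf', ?_, fun n => hle (hP.single_left n),
    hP.single_right⟩, hle, ?_⟩
  · intro z hz hz0
    obtain ⟨r, c, hc, h, hh, h1, h2⟩ := hP.splits_right z hz hz0
    exact ⟨r, c, hc, h, hle hh, h1, h2⟩
  · intro n
    induction n with
    | zero => simp [hk0]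
    | succ n ih =>
      have h1 := hk (show n < n + 1 by omega)
      rw [Finset.sum_range_succ, add_assoc]
      conv_lhs => rw [ih, hrec n]
      rw [smul_add, smul_smul, ← pow_add, show k n + (k (n + 1) - k n) = k (n + 1) by omega]

end Extension

/-! ### Killing functionals and endomorphisms -/

section Killing

variable {R : Type u} [CommRing R] {p : R}
variable {P : Submodule R (ℕ → R) × Submodule R (ℕ → R)}

/-- The restriction of a function to a submodule is linear. -/
def LinearOn {B : Type*} [AddCommGroup B] [Module R B] (N : Submodule R (ℕ → R))
    (u : (ℕ → R) → B) : Prop :=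
  (∀ x ∈ N, ∀ y ∈ N, u (x + y) = u x + u y) ∧ ∀ (a : R), ∀ x ∈ N, u (a • x) = a • u x

section LinearOn

variable {B : Type*} [AddCommGroup B] [Module R B] {N : Submodule R (ℕ → R)} {u : (ℕ → R) → B}

theorem LinearOn.mono (hu : LinearOn N u) {N' : Submodule R (ℕ → R)} (h : N' ≤ N) :
    LinearOn N' u :=
  ⟨fun x hx y hy => hu.1 x (h hx) y (h hy), fun a x hx => hu.2 a x (h hx)⟩

theorem LinearOn.congr (hu : LinearOn N u) {u' : (ℕ → R) → B} (h : Set.EqOn u' u N) :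
    LinearOn N u' := by
  refine ⟨fun x hx y hy => ?_, fun a x hx => ?_⟩
  · rw [h hx, h hy, h (N.add_mem hx hy), hu.1 x hx y hy]
  · rw [h hx, h (N.smul_mem a hx), hu.2 a x hx]

theorem LinearOn.map_zero (hu : LinearOn N u) : u 0 = 0 := by
  simpa using hu.2 0 0 N.zero_mem

theorem LinearOn.map_sum_smul (hu : LinearOn N u) {ι : Type*} (t : Finset ι) (a : ι → R)
    {x : ι → ℕ → R} (hx : ∀ i ∈ t, x i ∈ N) :
    u (∑ i ∈ t, a i • x i) = ∑ i ∈ t, a i • u (x i) := by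
  classical
  induction t using Finset.induction_on with
  | empty => simpa using hu.map_zero
  | insert j t hj ih =>
    have h1 := hx j (Finset.mem_insert_self j t)
    have h2 := fun i hi => hx i (Finset.mem_insert_of_mem (a := i) hi)
    rw [Finset.sum_insert hj, Finset.sum_insert hj, hu.1 _ (N.smul_mem _ h1) _
      (N.sum_mem fun i hi => N.smul_mem _ (h2 i hi)), hu.2 _ _ h1, ih h2]

end LinearOn

theorem HasPairing.dot_add (hp : AdicSeparated p) (hP : HasPairing p P) {x y z : ℕ → R}
    (hx : x ∈ P.1) (hy : y ∈ P.1) (hz : z ∈ P.2) : dot p (x + y) z = dot p x z + dot p y z :=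
  ((hP.pairsTo hx hz).add_left (hP.pairsTo hy hz)).dot_eq hp

theorem HasPairing.dot_smul (hp : AdicSeparated p) (hP : HasPairing p P) (a : R) {x z : ℕ → R}
    (hx : x ∈ P.1) (hz : z ∈ P.2) : dot p (a • x) z = a * dot p x z :=
  ((hP.pairsTo hx hz).smul_left a).dot_eq hp

theorem dot_comm (hp : AdicSeparated p) (x z : ℕ → R) : dot p x z = dot p z x := by
  by_cases h : ∃ r, PairsTo p x z r
  · obtain ⟨r, hr⟩ := h
    rw [hr.dot_eq hp, hr.symm.dot_eq hp]
  · rw [dot, dif_neg h, dot, dif_neg fun ⟨r, hr⟩ => h ⟨r, hr.symm⟩]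

theorem dot_single (hp : AdicSeparated p) (x : ℕ → R) (n : ℕ) : dot p x (Pi.single n 1) = x n :=
  (PairsTo.single_right x n).dot_eq hp

theorem HasPairing.linearOn_dot_left (hp : AdicSeparated p) (hP : HasPairing p P) {z : ℕ → R}
    (hz : z ∈ P.2) : LinearOn P.1 fun x => dot p x z :=
  ⟨fun _ hx _ hy => hP.dot_add hp hx hy hz, fun a _ hx => hP.dot_smul hp a hx hz⟩

theorem HasPairing.linearOn_dot_right (hp : AdicSeparated p) (hP : HasPairing p P) {x : ℕ → R}
    (hx : x ∈ P.1) : LinearOn P.2 fun z => dot p x z :=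
  (hP.swap.linearOn_dot_left hp (z := x) hx).congr fun z _ => dot_comm hp x z

theorem exists_forall_ne_pow_smul (hp : AdicSeparated p) (v : ℕ → R) (hv : v ≠ 0) :
    ∃ k : ℕ, ∀ w : ℕ → R, v ≠ p ^ k • w := by
  by_contra! hcon
  refine hv (funext fun n => hp _ fun k => ?_)
  obtain ⟨w, hw⟩ := hcon k
  exact ⟨w n, congrFun hw n⟩

variable [IsDomain R] [IsPrincipalIdealRing R] [Countable R]

/-- A functional on the left part that is not represented by the right part does not extend to
some good enlargement of the left part. -/
theorem GoodPair.exists_kill_functional (hp : AdicSeparated p) (hp0 : p ≠ 0) (hp1 : ¬ IsUnit p)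
    (hP : GoodPair p P) {φ : (ℕ → R) → R} (hφ : LinearOn P.1 φ)
    (hrep : ¬ ∃ h ∈ P.2, ∀ x ∈ P.1, φ x = dot p x h) :
    ∃ G' : Submodule R (ℕ → R), P.1 ≤ G' ∧ GoodPair p (G', P.2) ∧
      ∀ φ' : (ℕ → R) → R, LinearOn G' φ' → ¬ Set.EqOn φ' φ P.1 := by
  obtain ⟨b, b', hb⟩ := hP.exists_dual_bases hp
  -- If `φ` vanished on almost all basis elements, a finite combination of the dual basis would
  -- represent it.
  have ht : ∀ (i : R) N, ∃ n ≥ N, (fun (_ : R) n => φ (b n).1) i n ≠ 0 := by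
    intro _ N
    by_contra! hcon
    refine hrep ⟨∑ i ∈ Finset.range N, φ (b i).1 • (b' i).1,
      P.2.sum_mem fun i _ => P.2.smul_mem _ (b' i).2, ?_⟩
    have hmem : ∑ i ∈ Finset.range N, φ (b i).1 • (b' i).1 ∈ P.2 :=
      P.2.sum_mem fun i _ => P.2.smul_mem _ (b' i).2
    have hb1 : ∀ n, φ (b n).1 = dot p (b n).1 (∑ i ∈ Finset.range N, φ (b i).1 • (b' i).1) := by
      intro n
      rw [(hP.hasPairing.linearOn_dot_right hp (b n).2).map_sum_smul _ _ fun i _ => (b' i).2]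
      simp only [(hb n _).dot_eq hp, _root_.smul_eq_mul, mul_ite, mul_one, mul_zero,
        Finset.sum_ite_eq, Finset.mem_range]
      split_ifs with h
      · rfl
      · exact hcon n (not_lt.1 h)
    intro x hx
    have hx' := hx
    rw [← span_range_coe_basis b, Finsupp.mem_span_range_iff_exists_finsupp] at hx'
    obtain ⟨a, rfl⟩ := hx'
    rw [Finsupp.sum, hφ.map_sum_smul _ _ fun i _ => (b i).2,
      (hP.hasPairing.linearOn_dot_left hp hmem).map_sum_smul _ _ fun i _ => (b i).2]
    exact Finset.sum_congr rfl fun i _ => by rw [hb1 i]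
  have hB : ∀ v : R, v ≠ 0 → ∃ k : ℕ, ∀ w : R, v ≠ p ^ k • w := by
    intro v hv
    by_contra! hcon
    exact hv (hp v fun k => (hcon k).imp fun w hw => hw)
  obtain ⟨k, hk, hk0, hkn⟩ := exists_strictMono_avoiding hp0 hp1 hB _ id ht
  obtain ⟨y, hG, hle, hy⟩ := hP.exists_extension hp (span_range_coe_basis b)
    (span_range_coe_basis b') hb hk hk0
  refine ⟨_, hle, hG, fun φ' hφ' heq => ?_⟩
  obtain ⟨n, hn⟩ := hkn (φ' (y 0))
  have hyG : ∀ n, y n ∈ Submodule.span R (Set.range y) := fun n => Submodule.subset_span ⟨n, rfl⟩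
  -- The tail of the series for `φ' (y 0)` is `p ^ k n • φ' (y n)`, which contradicts the choice of
  -- `k` for the target `φ' (y 0)`.
  refine hn (-φ' (y n)) ?_
  have h1 : φ' (y 0) = ∑ j ∈ Finset.range n, p ^ k j • φ (b j).1 + p ^ k n • φ' (y n) := by
    conv_lhs => rw [hy n]
    rw [hφ'.1 _ (Submodule.sum_mem _ fun i _ => Submodule.smul_mem _ _ (hle (b i).2)) _
      (Submodule.smul_mem _ _ (hyG n)), hφ'.map_sum_smul _ _ fun i _ => hle (b i).2,
      hφ'.2 _ _ (hyG n)]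
    congr 1
    exact Finset.sum_congr rfl fun i _ => by rw [heq (b i).2]
  rw [id, h1, smul_neg, sub_add_cancel_left]

/-- An endomorphism of the left part with adjoint, which is injective and whose cokernel is not a
torsion module, does not extend beyond some good enlargement of the pair. -/
theorem GoodPair.exists_kill_endomorphism (hp : AdicSeparated p) (hp0 : p ≠ 0)
    (hp1 : ¬ IsUnit p) (hP : GoodPair p P) {η : (ℕ → R) → ℕ → R} (hη : LinearOn P.1 η)
    (hmaps : Set.MapsTo η P.1 P.1) (hinj : Set.InjOn η P.1)
    (hadj : ∀ z ∈ P.2, ∃ z' ∈ P.2, ∀ x ∈ P.1, dot p (η x) z = dot p x z') {g₀ : ℕ → R}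
    (hg₀ : g₀ ∈ P.1) (htor : ∀ (c : R), ∀ x ∈ P.1, c • g₀ = η x → c = 0) :
    ∃ P' : Submodule R (ℕ → R) × Submodule R (ℕ → R), P ≤ P' ∧ GoodPair p P' ∧
      ∀ Q, P' ≤ Q → HasPairing p Q → ∀ η' : (ℕ → R) → ℕ → R, LinearOn Q.1 η' →
        Set.MapsTo η' Q.1 Q.1 → ¬ Set.EqOn η' η P.1 := by
  obtain ⟨b, b', hb⟩ := hP.exists_dual_bases hp
  -- Pairing with the unit sequences recovers coordinates, so the adjoint is unique and given by
  -- this formula, which also makes it linear.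
  set A : (ℕ → R) → ℕ → R := fun z n => dot p (η (Pi.single n 1)) z with hA
  have hAz : ∀ z ∈ P.2, A z ∈ P.2 ∧ ∀ x ∈ P.1, dot p (η x) z = dot p x (A z) := by
    intro z hz
    obtain ⟨z', hz', h⟩ := hadj z hz
    have : A z = z' := by
      funext n
      rw [hA]
      simp only
      rw [h _ (hP.single_left n), dot_comm hp, dot_single hp]
    rw [this]
    exact ⟨hz', h⟩
  have hAadd : LinearOn P.2 A := by
    refine ⟨fun z hz w hw => funext fun n => ?_, fun a z hz => funext fun n => ?_⟩
    · exact (hP.hasPairing.linearOn_dot_right hp (hmaps (hP.single_left n))).1 z hz w hw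
    · exact (hP.hasPairing.linearOn_dot_right hp (hmaps (hP.single_left n))).2 a z hz
  have ht : ∀ (i : {s : R // s ≠ 0} × R × P.1) N, ∃ n ≥ N,
      (fun (i : {s : R // s ≠ 0} × R × P.1) n => i.1.1 • η (b n).1 - i.2.1 • (b n).1) i n ≠ 0 := by
    rintro ⟨⟨s, hs⟩, r, -⟩ N
    by_contra! hcon
    let η₁ : P.1 →ₗ[R] P.1 :=
      { toFun := fun x => ⟨η x, hmaps x.2⟩
        map_add' := fun x y => Subtype.ext (hη.1 x.1 x.2 y.1 y.2)
        map_smul' := fun a x => Subtype.ext (hη.2 a x.1 x.2) }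
    obtain ⟨c, hc, x, hx⟩ := exists_smul_mem_range_of_eventually_scalar b η₁
      (fun x y hxy => Subtype.ext (hinj x.2 y.2 (congrArg Subtype.val hxy))) hs N
      (r := r) (fun n hn => Subtype.ext (sub_eq_zero.1 (hcon n hn))) ⟨g₀, hg₀⟩
    exact hc (htor c x x.2 (congrArg Subtype.val hx).symm)
  have : Countable P.1 := hP.countable_left.to_subtype
  obtain ⟨k, hk, hk0, hkn⟩ := exists_strictMono_avoiding hp0 hp1
    (exists_forall_ne_pow_smul hp) _ (fun i => i.2.2.1) ht
  obtain ⟨y, hG, hle, hy⟩ := hP.exists_extension hp (span_range_coe_basis b)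
    (span_range_coe_basis b') hb hk hk0
  set G' := Submodule.span R (Set.range y) with hG'
  have hyG : ∀ n, y n ∈ G' := fun n => Submodule.subset_span ⟨n, rfl⟩
  set Y : ℕ → ℕ → R := fun n => ∑ j ∈ Finset.range n, p ^ k j • (b j).1 with hY
  have hYP : ∀ n, Y n ∈ P.1 := fun n => P.1.sum_mem fun j _ => P.1.smul_mem _ (b j).2
  have hdoty : ∀ n, ∀ z ∈ P.2, dot p (y 0) z = dot p (Y n) z + p ^ k n * dot p (y n) z := by
    intro n z hz
    conv_lhs => rw [hy n]
    rw [hG.hasPairing.dot_add hp (hle (hYP n)) (Submodule.smul_mem _ _ (hyG n)) hz,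
      hG.hasPairing.dot_smul hp _ (hyG n) hz]
  -- This is the functional that an image of `y 0` under an extension of `η` would have to induce on
  -- the right side.
  set ψ : (ℕ → R) → R := fun z => dot p (y 0) (A z) with hψ
  have hψlin : LinearOn P.2 ψ := by
    have h1 := hG.hasPairing.linearOn_dot_right hp (hyG 0)
    refine ⟨fun z hz w hw => ?_, fun a z hz => ?_⟩
    · rw [hψ]
      simp only
      rw [hAadd.1 z hz w hw]
      exact h1.1 _ (hAz z hz).1 _ (hAz w hw).1
    · rw [hψ]
      simp only
      rw [hAadd.2 a z hz]
      exact h1.2 a _ (hAz z hz).1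
  have hrep : ¬ ∃ w ∈ G', ∀ z ∈ P.2, ψ z = dot p z w := by
    rintro ⟨w, hw, hψw⟩
    -- Modulo `P.1`, the enlarged left side consists of `p`-power fractions of multiples of `y 0`. A
    -- representing `w` acts as `η (y 0)`, so `p ^ n • η (y 0) - r • y 0 = g` formally, which the
    -- choice of `k` forbids.
    obtain ⟨n, g, hg, r, hwg⟩ : ∃ n : ℕ, ∃ g ∈ P.1, ∃ r : R, p ^ n • w = g + r • y 0 := by
      clear hψw
      induction hw using Submodule.span_induction with
      | mem w hw =>
        obtain ⟨n, rfl⟩ := hw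
        refine ⟨k n, -Y n, P.1.neg_mem (hYP n), 1, ?_⟩
        rw [one_smul, hy n, neg_add_cancel_left]
      | zero => exact ⟨0, 0, P.1.zero_mem, 0, by simp⟩
      | add w w' _ _ hw hw' =>
        obtain ⟨n, g, hg, r, h⟩ := hw
        obtain ⟨n', g', hg', r', h'⟩ := hw'
        refine ⟨n + n', p ^ n' • g + p ^ n • g', P.1.add_mem (P.1.smul_mem _ hg)
          (P.1.smul_mem _ hg'), p ^ n' * r + p ^ n * r', ?_⟩
        have h1 : p ^ (n + n') • w = p ^ n' • (g + r • y 0) := by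
          rw [← h, smul_smul, ← pow_add, add_comm]
        have h2 : p ^ (n + n') • w' = p ^ n • (g' + r' • y 0) := by
          rw [← h', smul_smul, ← pow_add]
        rw [smul_add, h1, h2]
        module
      | smul a w _ hw =>
        obtain ⟨n, g, hg, r, h⟩ := hw
        refine ⟨n, a • g, P.1.smul_mem _ hg, a * r, ?_⟩
        rw [smul_comm, h, smul_add, mul_smul]
    obtain ⟨m, hm⟩ := hkn ⟨⟨p ^ n, pow_ne_zero n hp0⟩, r, ⟨g, hg⟩⟩
    refine hm (fun i => r * y m i - p ^ n * dot p (y m) (A (Pi.single i 1))) ?_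
    have h1 : ∑ j ∈ Finset.range m, p ^ k j • (p ^ n • η (b j).1 - r • (b j).1) =
        p ^ n • η (Y m) - r • Y m := by
      rw [hY]
      simp only
      rw [hη.map_sum_smul _ _ fun i _ => (b i).2, Finset.smul_sum, Finset.smul_sum,
        ← Finset.sum_sub_distrib]
      exact Finset.sum_congr rfl fun i _ => by rw [smul_sub, smul_comm (p ^ n), smul_comm r]
    simp only
    rw [h1]
    funext i
    have hs := hP.single_right i
    have h2 : η (Y m) i = dot p (Y m) (A (Pi.single i 1)) := by
      rw [← (hAz _ hs).2 _ (hYP m), dot_single hp]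
    have h3 := hdoty m _ (hAz _ hs).1
    have h4 : dot p (y 0) (A (Pi.single i 1)) = w i := by
      have := hψw _ hs
      rwa [dot_comm hp _ w, dot_single hp] at this
    have h5 := congrFun hwg i
    have h6 := congrFun (hy m) i
    simp only [Pi.add_apply, Pi.smul_apply, Pi.sub_apply, _root_.smul_eq_mul] at h5 h6 ⊢
    change y 0 i = Y m i + _ at h6
    rw [h2]
    linear_combination (-p ^ n) * h3 + p ^ n * h4 + h5 + r * h6
  obtain ⟨H', hH', hgood, hkill⟩ := hG.swap.exists_kill_functional hp hp0 hp1 hψlin hrep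
  refine ⟨(G', H'), ⟨hle, hH'⟩, hgood.swap, ?_⟩
  intro Q hQ hQp η' hη' hη'maps heq
  have hG'Q : G' ≤ Q.1 := hQ.1
  have hH'Q : H' ≤ Q.2 := hQ.2
  -- Pairing with `η' (y 0)` would extend `ψ` to `H'`. It agrees with `ψ` on `P.2` because the two
  -- differ by a multiple of `p ^ k l`, hence of `p ^ l`, for every `l`.
  refine hkill (fun z => dot p (η' (y 0)) z)
    ((hQp.linearOn_dot_right hp (hη'maps (hG'Q (hyG 0)))).mono hH'Q) fun z hz => ?_
  have hz' : z ∈ P.2 := hz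
  have hzQ : z ∈ Q.2 := hH'Q (hH' hz)
  refine sub_eq_zero.1 (hp _ fun l => ?_)
  have h1 : η' (y 0) = η (Y l) + p ^ k l • η' (y l) := by
    conv_lhs => rw [hy l]
    rw [hη'.1 _ (hG'Q (hle (hYP l))) _ (Q.1.smul_mem _ (hG'Q (hyG l))),
      hη'.2 _ _ (hG'Q (hyG l)), ← heq (hYP l)]
  have h2 : dot p (η' (y 0)) z = dot p (η (Y l)) z + p ^ k l * dot p (η' (y l)) z := by
    have h3 := hη'maps (hG'Q (hyG l))
    rw [h1, hQp.dot_add hp (hG'Q (hle (hmaps (hYP l)))) (Q.1.smul_mem _ h3) hzQ,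
      hQp.dot_smul hp _ h3 hzQ]
  have h3 := hdoty l _ (hAz z hz').1
  have h4 := (hAz z hz').2 _ (hYP l)
  refine (pow_dvd_pow p hk.le_apply).trans
    ⟨dot p (η' (y l)) z - dot p (y l) (A z), ?_⟩
  simp only [hψ]
  rw [h2, h3, h4]
  ring

end Killing

/-! ### Clubs in ω₁, consequences of diamond, and transfinite chains -/

section Club

theorem countable_Iio_omega_one (α : Set.Iio (ω₁ : Ordinal.{0})) : (Set.Iio α).Countable := by
  have h1 : (Set.Iio α.1).Countable := by
    rw [← Cardinal.le_aleph0_iff_set_countable, Cardinal.mk_Iio_ordinal, Cardinal.lift_le_aleph0]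
    have h2 : α.1 < (ℵ₁ : Cardinal.{0}).ord := by
      rw [Cardinal.ord_aleph]
      exact α.2
    rwa [Cardinal.lt_ord, ← Cardinal.succ_aleph0, Order.lt_succ_iff] at h2
  exact (h1.preimage Subtype.val_injective).mono fun β hβ => hβ

theorem exists_gt_of_countable_omega_one {s : Set (Set.Iio (ω₁ : Ordinal.{0}))}
    (hs : s.Countable) : ∃ γ, ∀ β ∈ s, β < γ := by
  have := hs.to_subtype
  have h1 : (⨆ β : s, Order.succ β.1.1) < ω₁ := by
    refine Ordinal.iSup_lt_omega_one fun β => ?_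
    exact (Cardinal.isSuccLimit_omega 1).succ_lt β.1.2
  refine ⟨⟨_, h1⟩, fun β hβ => ?_⟩
  exact (Order.lt_succ β.1).trans_le
    (Ordinal.le_iSup (fun β : s => Order.succ β.1.1) ⟨β, hβ⟩)

theorem isClub_closed_omega_one
    (f : Set.Iio (ω₁ : Ordinal.{0}) → Set.Iio (ω₁ : Ordinal.{0})) (γ : Set.Iio (ω₁ : Ordinal.{0})) :
    IsClub {α | γ < α ∧ ∀ β < α, f β < α} := by
  constructor
  · rintro s hs ⟨x, hx⟩ - a ha
    refine ⟨(hs hx).1.trans_le (ha.1 hx), fun β hβ => ?_⟩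
    obtain ⟨y, hy, hβy⟩ := (lt_isLUB_iff ha).1 hβ
    exact ((hs hy).2 β hβy).trans_le (ha.1 hy)
  · intro a
    have hstep : ∀ x, ∃ y, x < y ∧ ∀ β ≤ x, f β < y := by
      intro x
      have hc : (insert x (f '' Set.Iic x)).Countable := by
        refine Set.Countable.insert _ (Set.Countable.image ?_ _)
        rw [← Set.Iio_insert]
        exact (countable_Iio_omega_one x).insert x
      obtain ⟨y, hy⟩ := exists_gt_of_countable_omega_one hc
      exact ⟨y, hy x (Set.mem_insert _ _), fun β hβ => hy _ (Or.inr ⟨β, hβ, rfl⟩)⟩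
    choose g hg1 hg2 using hstep
    set s : ℕ → Set.Iio (ω₁ : Ordinal.{0}) := fun n => g^[n] (max a γ) with hs
    have hsucc : ∀ n, s (n + 1) = g (s n) := fun n => Function.iterate_succ_apply' g n _
    have hne : (upperBounds (Set.range s)).Nonempty := by
      obtain ⟨y, hy⟩ := exists_gt_of_countable_omega_one (Set.countable_range s)
      exact ⟨y, fun x hx => (hy x hx).le⟩
    set α := wellFounded_lt.min _ hne with hα
    have hub : α ∈ upperBounds (Set.range s) := wellFounded_lt.min_mem _ hne
    have hlub : IsLUB (Set.range s) α :=
      ⟨hub, fun y hy => not_lt.1 (wellFounded_lt.not_lt_min _ hy)⟩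
    have hlt : ∀ n, s n < α := fun n =>
      ((hg1 (s n)).trans_eq (hsucc n).symm).trans_le (hub ⟨n + 1, rfl⟩)
    have h0 : s 0 = max a γ := rfl
    refine ⟨α, ⟨(le_max_right a γ).trans_lt (h0 ▸ hlt 0), fun β hβ => ?_⟩,
      (le_max_left a γ).trans (h0 ▸ (hlt 0).le)⟩
    obtain ⟨_, ⟨n, rfl⟩, hn⟩ := (lt_isLUB_iff hlub).1 hβ
    exact ((hg2 (s n) β hn.le).trans_eq (hsucc n).symm).trans (hlt (n + 1))

/-- Countably many functions are dominated by a single `g` with `x < g x`. Closure under `g` gives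
closure under all of them and makes the point a limit. -/
theorem IsStationary.exists_closed {T : Set (Set.Iio (ω₁ : Ordinal.{0}))} (hT : IsStationary T)
    {ι : Type*} [Countable ι] (f : ι → Set.Iio (ω₁ : Ordinal.{0}) → Set.Iio (ω₁ : Ordinal.{0})) :
    ∃ α ∈ T, IsSuccLimit α ∧ ∀ i, ∀ β < α, f i β < α := by
  have hstep : ∀ x, ∃ y, x < y ∧ ∀ i, f i x < y := by
    intro x
    obtain ⟨y, hy⟩ := exists_gt_of_countable_omega_one
      ((Set.countable_range fun i => f i x).insert x)
    exact ⟨y, hy x (Set.mem_insert _ _), fun i => hy _ (Or.inr ⟨i, rfl⟩)⟩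
  choose g hg1 hg2 using hstep
  obtain ⟨γ⟩ : Nonempty (Set.Iio (ω₁ : Ordinal.{0})) := ⟨⟨0, Ordinal.omega_pos 1⟩⟩
  obtain ⟨α, hαT, hα, hcl⟩ := hT (isClub_closed_omega_one g γ)
  refine ⟨α, hαT, ⟨fun h => (not_lt.2 (h hα.le)) hα, fun β hβ => ?_⟩,
    fun i β hβ => (hg2 β i).trans (hcl β hβ)⟩
  exact hβ.2 (hg1 β) (hcl β hβ.1)

/-- A function on the members of an increasing family of countable sets is bounded on each
member. -/
theorem exists_bound_omega_one {X : Type*} (W : Set.Iio (ω₁ : Ordinal.{0}) → Set X)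
    (hW : ∀ α, (W α).Countable) (F : X → Set.Iio (ω₁ : Ordinal.{0})) :
    ∃ f : Set.Iio (ω₁ : Ordinal.{0}) → Set.Iio (ω₁ : Ordinal.{0}), ∀ β, ∀ x ∈ W β, F x < f β := by
  choose f hf using fun β => exists_gt_of_countable_omega_one ((hW β).image F)
  exact ⟨f, fun β x hx => hf β _ ⟨x, hx, rfl⟩⟩

/-- Diamond implies the continuum hypothesis: once `α` lies above the copy of `ℕ`, a correct guess
of the image of `Y ⊆ ℕ` recovers `Y`, so the guesses enumerate all subsets of `ℕ`. -/
theorem DiamondAlephOne.exists_injective (h : DiamondAlephOne) {K : Type u}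
    (hK : #K ≤ Cardinal.continuum) :
    ∃ c : K → Set.Iio (ω₁ : Ordinal.{0}), Function.Injective c := by
  obtain ⟨A, -, hA⟩ := h
  let ν : ℕ → Set.Iio (ω₁ : Ordinal.{0}) := fun n =>
    ⟨n, (Ordinal.natCast_lt_omega0 n).trans Ordinal.omega0_lt_omega_one⟩
  have hν : Function.Injective ν := fun m n hmn => by
    simpa [ν] using congrArg Subtype.val hmn
  have hsurj : Function.Surjective fun α => ν ⁻¹' A α := by
    intro Y
    obtain ⟨γ, hγ⟩ := exists_gt_of_countable_omega_one (Set.countable_range ν)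
    obtain ⟨α, hα, hlim, hcl⟩ := (hA (ν '' Y)).exists_closed (ι := Unit) fun _ _ => γ
    obtain ⟨β, hβ⟩ := not_isMin_iff.1 hlim.not_isMin
    refine ⟨α, ?_⟩
    simp only
    rw [← hα]
    ext n
    have h1 : ν n < α := (hγ _ ⟨n, rfl⟩).trans (hcl () β hβ)
    simp [hν.eq_iff, h1]
  obtain ⟨j⟩ : Nonempty (K ↪ Set ℕ) := by
    rw [← Cardinal.lift_mk_le', Cardinal.mk_set, Cardinal.mk_nat, Cardinal.two_power_aleph0,
      Cardinal.lift_continuum, Cardinal.lift_le_continuum]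
    exact hK
  exact ⟨fun x => Function.surjInv hsurj (j x),
    (Function.injective_surjInv hsurj).comp j.injective⟩

/-- Transfinite iteration of an extension step, with suprema at limits. -/
theorem exists_continuous_chain {L : Type u} [CompleteLattice L] {I : Type v} [LinearOrder I]
    [WellFoundedLT I] (hI : ∀ α : I, (Set.Iio α).Countable) (good : L → Prop) {P₀ : L}
    (h₀ : good P₀)
    (hsup : ∀ (ι : Type v) (P : ι → L) [Countable ι] [Nonempty ι], Directed (· ≤ ·) P →
      (∀ i, good (P i)) → good (⨆ i, P i))
    (rel : I → L → L → Prop) (hstep : ∀ α P, good P → ∃ P', P ≤ P' ∧ good P' ∧ rel α P P')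
    (hrel : ∀ α P P' P'', P' ≤ P'' → rel α P P' → rel α P P'') :
    ∃ S : I → L, Monotone S ∧ (∀ α, good (S α)) ∧ (∀ α β, α < β → rel α (S α) (S β)) ∧
      ∀ α, IsSuccLimit α → S α = ⨆ β, ⨆ _ : β < α, S β := by
  classical
  -- The step is made total, trivial where `P` is not good, so that the recursion can be run before
  -- goodness is known.
  have hstep' : ∀ α P, ∃ P', P ≤ P' ∧ (good P → good P' ∧ rel α P P') := by
    intro α P
    by_cases hP : good P
    · obtain ⟨P', h1, h2, h3⟩ := hstep α P hP
      exact ⟨P', h1, fun _ => ⟨h2, h3⟩⟩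
    · exact ⟨P, le_rfl, fun h => (hP h).elim⟩
  choose step hle hgood using hstep'
  -- One formula serves all indices. The value `none` contributes `P₀`, so the supremum is over a
  -- nonempty family even at the least index.
  let S : I → L := wellFounded_lt.fix fun α ih =>
    ⨆ o : Option (Set.Iio α), o.elim P₀ fun β => step β.1 (ih β.1 β.2)
  have hS : ∀ α, S α = ⨆ o : Option (Set.Iio α), o.elim P₀ fun β => step β.1 (S β.1) :=
    fun α => wellFounded_lt.fix_eq _ α
  have hstepS : ∀ α β, α < β → step α (S α) ≤ S β := by
    intro α β hαβ
    rw [hS β]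
    exact le_iSup (fun o : Option (Set.Iio β) => o.elim P₀ fun β => step β.1 (S β.1))
      (some ⟨α, hαβ⟩)
  have hP₀ : ∀ α, P₀ ≤ S α := by
    intro α
    rw [hS α]
    exact le_iSup (fun o : Option (Set.Iio α) => o.elim P₀ fun β => step β.1 (S β.1)) none
  have hmono : Monotone S := by
    intro α β hαβ
    rcases hαβ.eq_or_lt with rfl | h
    · exact le_rfl
    · exact (hle α (S α)).trans (hstepS α β h)
  have hg : ∀ α, good (S α) := by
    intro α
    induction α using WellFoundedLT.induction with
    | ind α ih =>
      rw [hS α]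
      have := (hI α).to_subtype
      refine hsup _ _ ?_ ?_
      · rintro (_ | ⟨β, hβ⟩) (_ | ⟨γ, hγ⟩)
        · exact ⟨none, le_rfl, le_rfl⟩
        · exact ⟨some ⟨γ, hγ⟩, (hP₀ γ).trans (hle γ _), le_rfl⟩
        · exact ⟨some ⟨β, hβ⟩, le_rfl, (hP₀ β).trans (hle β _)⟩
        · rcases le_total β γ with h | h
          · refine ⟨some ⟨γ, hγ⟩, ?_, le_rfl⟩
            rcases h.eq_or_lt with rfl | h
            · exact le_rfl
            · exact (hstepS β γ h).trans (hle γ _)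
          · refine ⟨some ⟨β, hβ⟩, le_rfl, ?_⟩
            rcases h.eq_or_lt with rfl | h
            · exact le_rfl
            · exact (hstepS γ β h).trans (hle β _)
      · rintro (_ | ⟨β, hβ⟩)
        · exact h₀
        · exact (hgood β _ (ih β hβ)).1
  refine ⟨S, hmono, hg, fun α β hαβ => hrel _ _ _ _ (hstepS α β hαβ) (hgood α _ (hg α)).2, ?_⟩
  intro α hα
  refine le_antisymm ?_ (iSup₂_le fun β hβ => hmono hβ.le)
  rw [hS α]
  refine iSup_le ?_
  rintro (_ | ⟨β, hβ⟩)
  · obtain ⟨β, hβ⟩ := not_isMin_iff.1 hα.not_isMin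
    exact (hP₀ β).trans (le_iSup₂ (f := fun β (_ : β < α) => S β) β hβ)
  · obtain ⟨γ, hβγ, hγα⟩ := hα.isSuccPrelimit.lt_iff_exists_lt.1 hβ
    exact (hstepS β γ hγα).trans (le_iSup₂ (f := fun β (_ : β < α) => S β) γ hβγ)

end Club

/-! ### Extensions that answer a prediction -/

section Prediction

variable {R : Type u} [CommRing R] {p : R}

/-- The tagged graph of the restriction of a function to a submodule. -/
def taggedGraph (t : ℕ) (N : Submodule R (ℕ → R)) (u : (ℕ → R) → ℕ → R) :
    Set (ℕ × (ℕ → R) × (ℕ → R)) :=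
  {q | q.1 = t ∧ q.2.1 ∈ N ∧ q.2.2 = u q.2.1}

theorem taggedGraph_tag {t t' : ℕ} {N N' : Submodule R (ℕ → R)} {u u' : (ℕ → R) → ℕ → R}
    (h : taggedGraph t N u = taggedGraph t' N' u') : t = t' := by
  have h1 : (t, 0, u 0) ∈ taggedGraph t N u := ⟨rfl, N.zero_mem, rfl⟩
  rw [h] at h1
  exact h1.1

theorem taggedGraph_eqOn {t : ℕ} {N : Submodule R (ℕ → R)} {u u' : (ℕ → R) → ℕ → R}
    (h : taggedGraph t N u = taggedGraph t N u') : Set.EqOn u u' N := by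
  intro x hx
  have h1 : (t, x, u x) ∈ taggedGraph t N u := ⟨rfl, hx, rfl⟩
  rw [h] at h1
  exact h1.2.2

/-- The functional coded by `D` is represented on `P` if it is linear on the left part of `P'`. -/
def HandlesFunctional (p : R) (t : ℕ) (D : Set (ℕ × (ℕ → R) × (ℕ → R)))
    (P P' : Submodule R (ℕ → R) × Submodule R (ℕ → R)) : Prop :=
  ∀ φ : (ℕ → R) → R, LinearOn P'.1 φ → D = taggedGraph t P.1 (fun x _ => φ x) →
    ∃ h ∈ P.2, ∀ x ∈ P.1, φ x = dot p x h

/-- If the endomorphism coded by `D` is injective with adjoint on `P` and extends beyond `P'`, then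
its cokernel is a torsion module. -/
def HandlesEndomorphism (p : R) (t : ℕ) (D : Set (ℕ × (ℕ → R) × (ℕ → R)))
    (P P' : Submodule R (ℕ → R) × Submodule R (ℕ → R)) : Prop :=
  ∀ Q, P' ≤ Q → HasPairing p Q → ∀ η : (ℕ → R) → ℕ → R, LinearOn Q.1 η →
    Set.MapsTo η Q.1 Q.1 → D = taggedGraph t P.1 η → Set.MapsTo η P.1 P.1 →
    Set.InjOn η P.1 → (∀ z ∈ P.2, ∃ z' ∈ P.2, ∀ x ∈ P.1, dot p (η x) z = dot p x z') →
    ∀ g₀ ∈ P.1, ∃ c : R, ∃ x ∈ P.1, c • g₀ = η x ∧ c ≠ 0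

/-- The extension `P'` of `P` takes care of the prediction `D`. -/
structure Handles (p : R) (D : Set (ℕ × (ℕ → R) × (ℕ → R)))
    (P P' : Submodule R (ℕ → R) × Submodule R (ℕ → R)) : Prop where
  left : HandlesFunctional p 0 D P P'
  right : HandlesFunctional p 1 D P.swap P'.swap
  endo : HandlesEndomorphism p 2 D P P'

variable {P P' P'' : Submodule R (ℕ → R) × Submodule R (ℕ → R)}
variable {D : Set (ℕ × (ℕ → R) × (ℕ → R))}

theorem HandlesFunctional.mono {t : ℕ} (h : HandlesFunctional p t D P P') (hle : P' ≤ P'') :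
    HandlesFunctional p t D P P'' :=
  fun φ hφ => h φ (hφ.mono hle.1)

theorem Handles.mono (h : Handles p D P P') (hle : P' ≤ P'') : Handles p D P P'' where
  left := h.left.mono hle
  right := h.right.mono (Prod.swap_le_swap.2 hle)
  endo := fun Q hQ => h.endo Q (hle.trans hQ)

theorem HandlesFunctional.of_ne {t t' : ℕ} {N : Submodule R (ℕ → R)} {u : (ℕ → R) → ℕ → R}
    (hD : D = taggedGraph t' N u) (ht : t ≠ t') : HandlesFunctional p t D P P' :=
  fun _ _ hD' => (ht (taggedGraph_tag (hD'.symm.trans hD))).elim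

theorem HandlesEndomorphism.of_ne {t t' : ℕ} {N : Submodule R (ℕ → R)} {u : (ℕ → R) → ℕ → R}
    (hD : D = taggedGraph t' N u) (ht : t ≠ t') : HandlesEndomorphism p t D P P' :=
  fun _ _ _ _ _ _ hD' => (ht (taggedGraph_tag (hD'.symm.trans hD))).elim

variable [IsDomain R] [IsPrincipalIdealRing R] [Countable R]

theorem GoodPair.exists_handlesFunctional (hp : AdicSeparated p) (hp0 : p ≠ 0)
    (hp1 : ¬ IsUnit p) (hP : GoodPair p P) {t : ℕ} {φ : (ℕ → R) → R} (hφ : LinearOn P.1 φ)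
    (hD : D = taggedGraph t P.1 fun x _ => φ x) :
    ∃ P', P ≤ P' ∧ GoodPair p P' ∧ HandlesFunctional p t D P P' := by
  have heq : ∀ φ' : (ℕ → R) → R, D = taggedGraph t P.1 (fun x _ => φ' x) →
      Set.EqOn φ' φ P.1 := fun φ' hD' x hx =>
    congrFun (taggedGraph_eqOn (hD'.symm.trans hD) hx) 0
  by_cases hrep : ∃ h ∈ P.2, ∀ x ∈ P.1, φ x = dot p x h
  · obtain ⟨h, hh, hφh⟩ := hrep
    exact ⟨P, le_rfl, hP, fun φ' _ hD' => ⟨h, hh, fun x hx => (heq φ' hD' hx).trans (hφh x hx)⟩⟩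
  · obtain ⟨G', hle, hG', hkill⟩ := hP.exists_kill_functional hp hp0 hp1 hφ hrep
    exact ⟨(G', P.2), ⟨hle, le_rfl⟩, hG', fun φ' hφ' hD' => (hkill φ' hφ' (heq φ' hD')).elim⟩

/-- The tags are distinct, so a prediction codes at most one kind of object, and a single kill
suffices. If the endomorphism requirement already holds with `P' = P`, nothing is added; otherwise
its failure supplies the `η` to kill. -/
theorem GoodPair.exists_handles (hp : AdicSeparated p) (hp0 : p ≠ 0) (hp1 : ¬ IsUnit p)
    (hP : GoodPair p P) (D : Set (ℕ × (ℕ → R) × (ℕ → R))) :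
    ∃ P', P ≤ P' ∧ GoodPair p P' ∧ Handles p D P P' := by
  by_cases h0 : ∃ φ : (ℕ → R) → R, LinearOn P.1 φ ∧ D = taggedGraph 0 P.1 fun x _ => φ x
  · obtain ⟨φ, hφ, hD⟩ := h0
    obtain ⟨P', h1, h2, h3⟩ := hP.exists_handlesFunctional hp hp0 hp1 hφ hD
    exact ⟨P', h1, h2, h3, .of_ne hD (by decide), .of_ne hD (by decide)⟩
  by_cases h1 : ∃ φ : (ℕ → R) → R, LinearOn P.2 φ ∧ D = taggedGraph 1 P.2 fun x _ => φ x
  · obtain ⟨φ, hφ, hD⟩ := h1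
    obtain ⟨P', h1, h2, h3⟩ := hP.swap.exists_handlesFunctional hp hp0 hp1 hφ hD
    exact ⟨P'.swap, Prod.swap_le_swap.2 h1, h2.swap, .of_ne hD (by decide), h3,
      .of_ne hD (by decide)⟩
  have hno : ∀ P', P ≤ P' → HandlesFunctional p 0 D P P' ∧
      HandlesFunctional p 1 D P.swap P'.swap := fun P' hP' =>
    ⟨fun φ hφ hD => (h0 ⟨φ, hφ.mono hP'.1, hD⟩).elim,
      fun φ hφ hD => (h1 ⟨φ, hφ.mono hP'.2, hD⟩).elim⟩
  by_cases h2 : HandlesEndomorphism p 2 D P P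
  · exact ⟨P, le_rfl, hP, (hno P le_rfl).1, (hno P le_rfl).2, h2⟩
  · unfold HandlesEndomorphism at h2
    push Not at h2
    obtain ⟨Q, hPQ, hQ, η, hη, -, hD, hmaps, hinj, hadj, g₀, hg₀, htor⟩ := h2
    obtain ⟨P', hle, hgood, hkill⟩ := hP.exists_kill_endomorphism hp hp0 hp1 (hη.mono hPQ.1)
      hmaps hinj hadj hg₀ htor
    refine ⟨P', hle, hgood, (hno P' hle).1, (hno P' hle).2, ?_⟩
    intro Q' hQ' hQ'p η' hη' hmaps' hD'
    exact (hkill Q' hQ' hQ'p η' hη' hmaps' (taggedGraph_eqOn (hD'.symm.trans hD))).elim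

end Prediction

/-! ### Diamond for functions on filtered modules -/

section Guessing

variable {R : Type u} [CommRing R] {p : R}

/-- The sequence `D` guesses the tagged graph of every function on the union of a continuous chain
of countable modules, at a stage that is closed under given operations. -/
def Guesses (D : Set.Iio (ω₁ : Ordinal.{0}) → Set (ℕ × (ℕ → R) × (ℕ → R))) : Prop :=
  ∀ (W : Set.Iio (ω₁ : Ordinal.{0}) → Submodule R (ℕ → R)),
    (∀ α, (W α : Set (ℕ → R)).Countable) → Monotone W →
    (∀ α, IsSuccLimit α → ∀ x ∈ W α, ∃ β < α, x ∈ W β) →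
    ∀ (t : ℕ) (u : (ℕ → R) → ℕ → R) (f : ℕ → Set.Iio (ω₁ : Ordinal.{0}) →
      Set.Iio (ω₁ : Ordinal.{0})),
      ∃ α, IsSuccLimit α ∧ (∀ i, ∀ β < α, f i β < α) ∧ D α = taggedGraph t (W α) u

theorem DiamondAlephOne.exists_guesses [Countable R] (h : DiamondAlephOne) :
    ∃ D : Set.Iio (ω₁ : Ordinal.{0}) → Set (ℕ × (ℕ → R) × (ℕ → R)), Guesses D := by
  have hK : #(ℕ × (ℕ → R) × (ℕ → R)) ≤ Cardinal.continuum := by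
    have h1 : #(ℕ → R) ≤ Cardinal.continuum := by
      rw [Cardinal.mk_arrow, ← Cardinal.aleph0_power_aleph0, Cardinal.mk_nat,
        Cardinal.lift_aleph0, Cardinal.lift_uzero]
      exact Cardinal.power_le_power_right Cardinal.mk_le_aleph0
    rw [Cardinal.mk_prod, Cardinal.mk_prod, Cardinal.mk_nat,
      Cardinal.lift_aleph0, Cardinal.lift_uzero, Cardinal.lift_id]
    calc _ ≤ Cardinal.continuum * (Cardinal.continuum * Cardinal.continuum) := by
          gcongr
          exact Cardinal.aleph0_le_continuum
      _ = _ := by simp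
  obtain ⟨c, hc⟩ := h.exists_injective hK
  obtain ⟨A, -, hA⟩ := h
  refine ⟨fun α => {q | c q ∈ A α}, fun W hW hmono hlim t u f => ?_⟩
  -- Closure under `f₁` keeps the codes of elements of `W α` below `α`; closure under `f₂` ensures
  -- that codes below `α` come from `W α`. Hence the coded graph cut off at `α` is exactly the code
  -- of the graph on `W α`.
  obtain ⟨f₁, hf₁⟩ := exists_bound_omega_one (fun α => (W α : Set (ℕ → R))) hW
    fun x => c (t, x, u x)
  have h2 : ∀ β, ∃ γ, ∀ x, (∃ δ, x ∈ W δ) → c (t, x, u x) = β → x ∈ W γ := by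
    intro β
    by_cases hβ : ∃ x, (∃ δ, x ∈ W δ) ∧ c (t, x, u x) = β
    · obtain ⟨x, ⟨δ, hδ⟩, hx⟩ := hβ
      refine ⟨δ, fun y _ hy => ?_⟩
      have h3 := hc (hy.trans hx.symm)
      simp only [Prod.mk.injEq, true_and] at h3
      exact h3.1 ▸ hδ
    · exact ⟨β, fun x hx hxc => (hβ ⟨x, hx, hxc⟩).elim⟩
  choose f₂ hf₂ using h2
  obtain ⟨α, hα, hαlim, hcl⟩ := (hA ((fun x => c (t, x, u x)) '' ⋃ δ, (W δ : Set (ℕ → R))))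
    |>.exists_closed (ι := Option (Option ℕ)) fun o => o.elim f₁ fun o => o.elim f₂ f
  refine ⟨α, hαlim, fun i β hβ => hcl (some (some i)) β hβ, ?_⟩
  simp only [Set.mem_ofPred_eq] at hα
  ext ⟨t', x, y⟩
  simp only [Set.mem_ofPred_eq, ← hα, taggedGraph]
  constructor
  · rintro ⟨⟨x', hx', hx'c⟩, hlt⟩
    have h3 := hc hx'c
    simp only [Prod.mk.injEq] at h3
    obtain ⟨rfl, rfl, rfl⟩ := h3
    exact ⟨rfl, hmono (hcl (some none) _ hlt).le (hf₂ _ x' (Set.mem_iUnion.1 hx') rfl), rfl⟩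
  · rintro ⟨rfl, hx, rfl⟩
    refine ⟨⟨x, Set.mem_iUnion.2 ⟨α, hx⟩, rfl⟩, ?_⟩
    obtain ⟨β, hβ, hxβ⟩ := hlim α hαlim x hx
    exact (hf₁ β x hxβ).trans (hcl none β hβ)

end Guessing

/-! ### The union of the chain -/

section GuessingChain

variable {R : Type u} [CommRing R] {p : R}
variable {D : Set.Iio (ω₁ : Ordinal.{0}) → Set (ℕ × (ℕ → R) × (ℕ → R))}
variable {S : Set.Iio (ω₁ : Ordinal.{0}) → Submodule R (ℕ → R) × Submodule R (ℕ → R)}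

/-- A continuous chain of good pairs, at each stage of which the prediction `D` is handled. -/
structure GuessingChain (p : R)
    (D : Set.Iio (ω₁ : Ordinal.{0}) → Set (ℕ × (ℕ → R) × (ℕ → R)))
    (S : Set.Iio (ω₁ : Ordinal.{0}) → Submodule R (ℕ → R) × Submodule R (ℕ → R)) : Prop where
  guesses : Guesses D
  mono : Monotone S
  good : ∀ α, GoodPair p (S α)
  handles : ∀ α β, α < β → Handles p (D α) (S α) (S β)
  continuous : ∀ α, IsSuccLimit α → S α = ⨆ β, ⨆ _ : β < α, S β

theorem DiamondAlephOne.exists_guessingChain [IsDomain R] [IsPrincipalIdealRing R] [Countable R]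
    (h : DiamondAlephOne) (hp : AdicSeparated p) (hp0 : p ≠ 0) (hp1 : ¬ IsUnit p) :
    ∃ D S, GuessingChain p D S := by
  obtain ⟨D, hD⟩ := h.exists_guesses (R := R)
  obtain ⟨S, h1, h2, h3, h4⟩ := exists_continuous_chain countable_Iio_omega_one (GoodPair p)
    (goodPair_singlePair hp) (fun ι P _ _ hd hP => GoodPair.iSup hd hP)
    (fun α P P' => Handles p (D α) P P') (fun α P hP => hP.exists_handles hp hp0 hp1 (D α))
    fun α P P' P'' hle hP => hP.mono hle
  exact ⟨D, S, hD, h1, h2, h3, h4⟩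

theorem mem_iSup_of_monotone {W : Set.Iio (ω₁ : Ordinal.{0}) → Submodule R (ℕ → R)}
    (hW : Monotone W) (x : ℕ → R) : x ∈ ⨆ α, W α ↔ ∃ α, x ∈ W α := by
  have : Nonempty (Set.Iio (ω₁ : Ordinal.{0})) := ⟨⟨0, Ordinal.omega_pos 1⟩⟩
  exact Submodule.mem_iSup_of_directed _ hW.directed_le

/-- An increasing continuous family of countable modules. -/
structure CountableFiltration (W : Set.Iio (ω₁ : Ordinal.{0}) → Submodule R (ℕ → R)) : Prop where
  countable : ∀ α, (W α : Set (ℕ → R)).Countable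
  mono : Monotone W
  exists_lt : ∀ α, IsSuccLimit α → ∀ x ∈ W α, ∃ β < α, x ∈ W β

theorem exists_lt_mem_of_eq_iSup {W : Set.Iio (ω₁ : Ordinal.{0}) → Submodule R (ℕ → R)}
    (hW : Monotone W) {α : Set.Iio (ω₁ : Ordinal.{0})} (hα : IsSuccLimit α)
    (h : W α = ⨆ β, ⨆ _ : β < α, W β) {x : ℕ → R} (hx : x ∈ W α) : ∃ β < α, x ∈ W β := by
  obtain ⟨β, hβ⟩ := not_isMin_iff.1 hα.not_isMin
  have : Nonempty {β // β < α} := ⟨⟨β, hβ⟩⟩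
  rw [h, iSup_subtype', Submodule.mem_iSup_of_directed] at hx
  · obtain ⟨⟨β, hβ⟩, hx⟩ := hx
    exact ⟨β, hβ, hx⟩
  · exact Monotone.directed_le fun β γ hβγ => hW hβγ

theorem GuessingChain.filtration_left (hS : GuessingChain p D S) :
    CountableFiltration fun α => (S α).1 where
  countable α := (hS.good α).countable_left
  mono α β hαβ := (hS.mono hαβ).1
  exists_lt α hα x hx := by
    refine exists_lt_mem_of_eq_iSup (W := fun α => (S α).1) (fun α β hαβ => (hS.mono hαβ).1) hα
      ?_ hx
    have := congrArg Prod.fst (hS.continuous α hα)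
    simpa only [Prod.fst_iSup] using this

theorem GuessingChain.filtration_right (hS : GuessingChain p D S) :
    CountableFiltration fun α => (S α).2 where
  countable α := (hS.good α).countable_right
  mono α β hαβ := (hS.mono hαβ).2
  exists_lt α hα x hx := by
    refine exists_lt_mem_of_eq_iSup (W := fun α => (S α).2) (fun α β hαβ => (hS.mono hαβ).2) hα
      ?_ hx
    have := congrArg Prod.snd (hS.continuous α hα)
    simpa only [Prod.snd_iSup] using this

theorem GuessingChain.hasPairing (hS : GuessingChain p D S) : HasPairing p (⨆ α, S α) := by
  intro x hx z hz
  rw [Prod.fst_iSup, mem_iSup_of_monotone hS.filtration_left.mono] at hx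
  rw [Prod.snd_iSup, mem_iSup_of_monotone hS.filtration_right.mono] at hz
  obtain ⟨α, hα⟩ := hx
  obtain ⟨β, hβ⟩ := hz
  exact (hS.good (max α β)).hasPairing x ((hS.mono (le_max_left α β)).1 hα) z
    ((hS.mono (le_max_right α β)).2 hβ)

/-- A map from the union of a filtration to the union of another one preserves the stages that are
closed under some operation. -/
theorem CountableFiltration.exists_closing {W V : Set.Iio (ω₁ : Ordinal.{0}) →
    Submodule R (ℕ → R)} (hW : CountableFiltration W) (hV : CountableFiltration V)
    {F : (ℕ → R) → ℕ → R} (hF : ∀ x ∈ ⨆ α, W α, F x ∈ ⨆ α, V α) :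
    ∃ f : Set.Iio (ω₁ : Ordinal.{0}) → Set.Iio (ω₁ : Ordinal.{0}),
      ∀ α, IsSuccLimit α → (∀ β < α, f β < α) → ∀ x ∈ W α, F x ∈ V α := by
  have h1 : ∀ x, ∃ α, x ∈ ⨆ α, W α → F x ∈ V α := by
    intro x
    by_cases hx : x ∈ ⨆ α, W α
    · obtain ⟨α, hα⟩ := (mem_iSup_of_monotone hV.mono _).1 (hF x hx)
      exact ⟨α, fun _ => hα⟩
    · exact ⟨⟨0, Ordinal.omega_pos 1⟩, fun h => (hx h).elim⟩
  choose i hi using h1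
  obtain ⟨f, hf⟩ := exists_bound_omega_one (fun α => (W α : Set (ℕ → R))) hW.countable i
  refine ⟨f, fun α hα hcl x hx => ?_⟩
  obtain ⟨β, hβ, hxβ⟩ := hW.exists_lt α hα x hx
  exact hV.mono ((hf β x hxβ).trans (hcl β hβ)).le
    (hi x ((mem_iSup_of_monotone hW.mono x).2 ⟨α, hx⟩))

/-- Otherwise each `h` fails at some witness `g h`. At a correctly guessed stage closed under `g`,
the representing element would have its witness of failure in the same stage. -/
theorem Guesses.exists_represented {W V : Set.Iio (ω₁ : Ordinal.{0}) → Submodule R (ℕ → R)}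
    (hD : Guesses D) (hW : CountableFiltration W) (hV : CountableFiltration V) {t : ℕ}
    {φ : (ℕ → R) → R}
    (hφ : ∀ α, D α = taggedGraph t (W α) (fun x _ => φ x) →
      ∃ h ∈ V α, ∀ x ∈ W α, φ x = dot p x h) :
    ∃ h ∈ ⨆ α, V α, ∀ x ∈ ⨆ α, W α, φ x = dot p x h := by
  by_contra! hcon
  have h1 : ∀ h, ∃ x, h ∈ ⨆ α, V α → x ∈ ⨆ α, W α ∧ φ x ≠ dot p x h := by
    intro h
    by_cases hh : h ∈ ⨆ α, V α
    · obtain ⟨x, hx⟩ := hcon h hh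
      exact ⟨x, fun _ => hx⟩
    · exact ⟨0, fun h => (hh h).elim⟩
  choose g hg using h1
  obtain ⟨f, hf⟩ := hV.exists_closing hW fun h hh => (hg h hh).1
  obtain ⟨α, hα, hcl, hDα⟩ := hD W hW.countable hW.mono hW.exists_lt t (fun x _ => φ x) fun _ => f
  obtain ⟨h, hh, hrep⟩ := hφ α hDα
  exact (hg h ((mem_iSup_of_monotone hV.mono h).2 ⟨α, hh⟩)).2 (hrep _ (hf α hα (hcl 0) h hh))

theorem exists_gt_omega_one (α : Set.Iio (ω₁ : Ordinal.{0})) : ∃ β, α < β := by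
  obtain ⟨β, hβ⟩ := exists_gt_of_countable_omega_one (Set.countable_singleton α)
  exact ⟨β, hβ α rfl⟩

theorem GuessingChain.exists_represented_left (hS : GuessingChain p D S) {φ : (ℕ → R) → R}
    (hφ : LinearOn (⨆ α, S α).1 φ) :
    ∃ h ∈ (⨆ α, S α).2, ∀ x ∈ (⨆ α, S α).1, φ x = dot p x h := by
  rw [Prod.fst_iSup, Prod.snd_iSup]
  refine hS.guesses.exists_represented hS.filtration_left hS.filtration_right
    (t := 0) fun α hα => ?_
  obtain ⟨β, hβ⟩ := exists_gt_omega_one α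
  exact (hS.handles α β hβ).left φ (hφ.mono (le_iSup S β).1) hα

theorem GuessingChain.exists_represented_right (hS : GuessingChain p D S) {φ : (ℕ → R) → R}
    (hφ : LinearOn (⨆ α, S α).2 φ) :
    ∃ h ∈ (⨆ α, S α).1, ∀ x ∈ (⨆ α, S α).2, φ x = dot p x h := by
  rw [Prod.fst_iSup, Prod.snd_iSup]
  refine hS.guesses.exists_represented hS.filtration_right hS.filtration_left
    (t := 1) fun α hα => ?_
  obtain ⟨β, hβ⟩ := exists_gt_omega_one α
  exact (hS.handles α β hβ).right φ (hφ.mono (le_iSup S β).2) hα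

/-- Injective endomorphisms of the left part of the union have torsion cokernel. -/
theorem GuessingChain.exists_smul_eq (hp : AdicSeparated p) (hS : GuessingChain p D S)
    {η : (ℕ → R) → ℕ → R} (hη : LinearOn (⨆ α, S α).1 η)
    (hmaps : Set.MapsTo η (⨆ α, S α).1 (⨆ α, S α).1) (hinj : Set.InjOn η (⨆ α, S α).1)
    {g₀ : ℕ → R} (hg₀ : g₀ ∈ (⨆ α, S α).1) :
    ∃ c : R, ∃ x ∈ (⨆ α, S α).1, c • g₀ = η x ∧ c ≠ 0 := by
  -- Adjoints exist on the whole union because all functionals are represented; the reflection below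
  -- then picks a stage closed under `η` and the adjoint and containing `g₀`.
  have hadj : ∀ z, ∃ z', z ∈ (⨆ α, S α).2 →
      z' ∈ (⨆ α, S α).2 ∧ ∀ x ∈ (⨆ α, S α).1, dot p (η x) z = dot p x z' := by
    intro z
    by_cases hz : z ∈ (⨆ α, S α).2
    · have hlin := hS.hasPairing.linearOn_dot_left hp hz
      obtain ⟨z', hz', h⟩ := hS.exists_represented_left (φ := fun x => dot p (η x) z)
        ⟨fun x hx y hy => by
          simp only [hη.1 x hx y hy]
          exact hlin.1 _ (hmaps hx) _ (hmaps hy), fun a x hx => by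
          simp only [hη.2 a x hx]
          exact hlin.2 a _ (hmaps hx)⟩
      exact ⟨z', fun _ => ⟨hz', h⟩⟩
    · exact ⟨0, fun h => (hz h).elim⟩
  choose A hA using hadj
  have e1 : (⨆ α, S α).1 = ⨆ α, (S α).1 := Prod.fst_iSup _
  have e2 : (⨆ α, S α).2 = ⨆ α, (S α).2 := Prod.snd_iSup _
  obtain ⟨f₁, hf₁⟩ := hS.filtration_left.exists_closing hS.filtration_left (F := η)
    fun x hx => by
      rw [← e1] at hx ⊢
      exact hmaps hx
  obtain ⟨f₂, hf₂⟩ := hS.filtration_right.exists_closing hS.filtration_right (F := A)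
    fun x hx => by
      rw [← e2] at hx ⊢
      exact (hA x hx).1
  obtain ⟨f₃, hf₃⟩ := hS.filtration_left.exists_closing hS.filtration_left (F := fun _ => g₀)
    fun x hx => by rwa [← e1]
  obtain ⟨α, hα, hcl, hDα⟩ := hS.guesses _ hS.filtration_left.countable hS.filtration_left.mono
    hS.filtration_left.exists_lt 2 η fun n => if n = 0 then f₁ else if n = 1 then f₂ else f₃
  obtain ⟨β, hβ⟩ := exists_gt_omega_one α
  have hle := le_iSup S α
  obtain ⟨c, x, hx, hc⟩ := (hS.handles α β hβ).endo _ (le_iSup S β) hS.hasPairing η hη hmaps hDα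
    (fun x hx => hf₁ α hα (hcl 0) x hx) (hinj.mono hle.1)
    (fun z hz => ⟨A z, hf₂ α hα (hcl 1) z hz, fun x hx => (hA z (hle.2 hz)).2 x (hle.1 hx)⟩) g₀
    (hf₃ α hα (hcl 2) 0 (Submodule.zero_mem _))
  exact ⟨c, x, hle.1 hx, hc⟩

open Classical in
theorem LinearMap.linearOn_extend {B : Type*} [AddCommGroup B] [Module R B]
    {N : Submodule R (ℕ → R)} (φ : N →ₗ[R] B) :
    LinearOn N fun x => if hx : x ∈ N then φ ⟨x, hx⟩ else 0 := by
  refine ⟨fun x hx y hy => ?_, fun a x hx => ?_⟩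
  · simp only [dif_pos hx, dif_pos hy, dif_pos (N.add_mem hx hy), ← map_add]
    rfl
  · simp only [dif_pos hx, dif_pos (N.smul_mem a hx), ← map_smul]
    rfl

/-- Injectivity on both sides comes from the unit sequences, which detect coordinates; surjectivity
is the representation of functionals. -/
theorem GuessingChain.isPerfPair (hp : AdicSeparated p) (hS : GuessingChain p D S) :
    (adicForm hp hS.hasPairing).IsPerfPair := by
  classical
  obtain ⟨γ⟩ : Nonempty (Set.Iio (ω₁ : Ordinal.{0})) := ⟨⟨0, Ordinal.omega_pos 1⟩⟩
  have hs1 := fun n => (le_iSup S γ).1 ((hS.good γ).single_left n)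
  have hs2 := fun n => (le_iSup S γ).2 ((hS.good γ).single_right n)
  refine ⟨⟨?_, fun φ => ?_⟩, ⟨?_, fun φ => ?_⟩⟩
  · refine (injective_iff_map_eq_zero _).2 fun x hx => Subtype.ext (funext fun n => ?_)
    rw [← dot_single hp x.1 n]
    exact DFunLike.congr_fun hx ⟨_, hs2 n⟩
  · obtain ⟨x, hx, h⟩ := hS.exists_represented_right φ.linearOn_extend
    refine ⟨⟨x, hx⟩, LinearMap.ext fun z => ?_⟩
    have := h z.1 z.2
    rw [dif_pos z.2, dot_comm hp] at this
    exact this.symm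
  · refine (injective_iff_map_eq_zero _).2 fun x hx => Subtype.ext (funext fun n => ?_)
    rw [← dot_single hp x.1 n, dot_comm hp]
    exact DFunLike.congr_fun hx ⟨_, hs1 n⟩
  · obtain ⟨x, hx, h⟩ := hS.exists_represented_left φ.linearOn_extend
    refine ⟨⟨x, hx⟩, LinearMap.ext fun z => ?_⟩
    have := h z.1 z.2
    rw [dif_pos z.2] at this
    exact this.symm

/-- An isomorphism `θ` makes the inclusion of the second summand an injective endomorphism. No
nonzero multiple of `θ.symm (1, 0)` lies in its range, so its cokernel is not torsion. -/
theorem GuessingChain.isEmpty_linearEquiv [Nontrivial R] (hp : AdicSeparated p)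
    (hS : GuessingChain p D S) : IsEmpty ((⨆ α, S α).1 ≃ₗ[R] R × (⨆ α, S α).1) := by
  classical
  refine ⟨fun θ => ?_⟩
  set Q := (⨆ α, S α).1
  set η : Q →ₗ[R] Q := θ.symm.toLinearMap ∘ₗ LinearMap.inr R R Q
  have hηx : ∀ x (hx : x ∈ Q), (if hx : x ∈ Q then (Q.subtype ∘ₗ η) ⟨x, hx⟩ else 0) =
      (η ⟨x, hx⟩).1 := fun x hx => dif_pos hx
  obtain ⟨c, x, hx, hcx, hc⟩ := hS.exists_smul_eq hp (Q.subtype ∘ₗ η).linearOn_extend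
    (fun x hx => by
      rw [hηx x hx]
      exact (η ⟨x, hx⟩).2)
    (fun x hx y hy hxy => by
      have hxy := (hηx x hx).symm.trans (hxy.trans (hηx y hy))
      have h3 := LinearMap.inr_injective (θ.symm.injective (Subtype.ext hxy))
      exact congrArg Subtype.val h3)
    (θ.symm (1, 0)).2
  rw [hηx x hx] at hcx
  have h1 : θ.symm (c • (1, 0)) = θ.symm (0, ⟨x, hx⟩) := by
    rw [map_smul]
    exact Subtype.ext hcx
  have h2 := congrArg Prod.fst (θ.symm.injective h1)
  exact hc (by simpa using h2)

theorem GuessingChain.mk_eq [IsDomain R] (hp : AdicSeparated p) (hS : GuessingChain p D S) :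
    #(⨆ α, S α).1 = ℵ₁ := by
  have hmem : ∀ x, x ∈ (⨆ α, S α).1 ↔ ∃ α, x ∈ (S α).1 := by
    rw [Prod.fst_iSup]
    exact mem_iSup_of_monotone hS.filtration_left.mono
  refine le_antisymm ?_ ?_
  · have hex : ∀ α, ∃ e : ℕ → (S α).1, Function.Surjective e := fun α =>
      have := (hS.good α).countable_left.to_subtype
      exists_surjective_nat _
    choose e he using hex
    have hsurj : Function.Surjective
        (fun q : Set.Iio (ω₁ : Ordinal.{0}) × ℕ =>
          (⟨(e q.1 q.2).1, (le_iSup S q.1).1 (e q.1 q.2).2⟩ : (⨆ α, S α).1)) := by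
      rintro ⟨x, hx⟩
      obtain ⟨α, hα⟩ := (hmem x).1 hx
      obtain ⟨n, hn⟩ := he α ⟨x, hα⟩
      exact ⟨(α, n), Subtype.ext (congrArg (fun y : (S α).1 => y.1) hn)⟩
    have h1 := Cardinal.lift_mk_le_lift_mk_of_surjective hsurj
    rw [← Cardinal.lift_le.{1}]
    refine h1.trans (le_of_eq ?_)
    simp
  · by_contra hcon
    rw [not_le, ← Cardinal.succ_aleph0, Order.lt_succ_iff,
      Cardinal.le_aleph0_iff_subtype_countable] at hcon
    obtain ⟨γ₀⟩ : Nonempty (Set.Iio (ω₁ : Ordinal.{0})) := ⟨⟨0, Ordinal.omega_pos 1⟩⟩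
    have : Nonempty (Set.Iio (ω₁ : Ordinal.{0})) := ⟨γ₀⟩
    choose! i hi using fun x => (hmem x).1
    -- If the union were countable, the chain would be constant on the left from some `γ` on. A
    -- basis indexed by `ℕ` then absorbs one more element and gives the forbidden isomorphism.
    obtain ⟨γ, hγ⟩ := exists_gt_of_countable_omega_one (hcon.image i)
    have heq : (S γ).1 = (⨆ α, S α).1 := by
      refine le_antisymm (le_iSup S γ).1 fun x hx => ?_
      exact (hS.mono (hγ _ ⟨x, hx, rfl⟩).le).1 (hi x hx)
    obtain ⟨b, -⟩ := (hS.good γ).exists_dual_bases hp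
    rw [heq] at b
    obtain ⟨j⟩ : Nonempty (ℕ ≃ Unit ⊕ ℕ) := nonempty_equiv_of_countable
    exact (hS.isEmpty_linearEquiv hp).false (b.equiv ((Module.Basis.singleton Unit R).prod b) j)

theorem IsPureSubmodule.submoduleOf {M : Type u} [AddCommGroup M] [Module R M]
    {N N' : Submodule R M} (hN : IsPureSubmodule N) (h : N ≤ N') :
    IsPureSubmodule (N.submoduleOf N') := by
  rintro r ⟨m, hm⟩ hrm
  obtain ⟨n, hn, hnm⟩ := hN r m hrm
  exact ⟨⟨n, h hn⟩, hn, Subtype.ext hnm⟩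

theorem GuessingChain.isUnionOfFormChain [IsDomain R] (hp : AdicSeparated p)
    (hS : GuessingChain p D S) :
    IsUnionOfFormChain (R := R) (G := (⨆ α, S α).1) (H := (⨆ α, S α).2)
      (adicForm hp hS.hasPairing) (fun α => (S α).1.submoduleOf (⨆ α, S α).1)
      (fun α => (S α).2.submoduleOf (⨆ α, S α).2) := by
  have m1 : Monotone fun α => (S α).1.submoduleOf (⨆ α, S α).1 :=
    fun α β hαβ x hx => (hS.mono hαβ).1 hx
  have m2 : Monotone fun α => (S α).2.submoduleOf (⨆ α, S α).2 :=
    fun α β hαβ x hx => (hS.mono hαβ).2 hx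
  have u1 : ∀ x, x ∈ (⨆ α, S α).1 → ∃ α, x ∈ (S α).1 := by
    rw [Prod.fst_iSup]
    exact fun x => (mem_iSup_of_monotone hS.filtration_left.mono x).1
  have u2 : ∀ x, x ∈ (⨆ α, S α).2 → ∃ α, x ∈ (S α).2 := by
    rw [Prod.snd_iSup]
    exact fun x => (mem_iSup_of_monotone hS.filtration_right.mono x).1
  refine ⟨m1, m2, ?_, ?_, ?_, ?_, ?_, ?_, ?_, ?_⟩
  · intro α hα
    refine le_antisymm (fun x hx => ?_) (iSup₂_le fun β hβ => m1 hβ.le)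
    obtain ⟨β, hβ, hxβ⟩ := hS.filtration_left.exists_lt α hα x.1 hx
    exact le_iSup₂ (f := fun β (_ : β < α) => (S β).1.submoduleOf (⨆ α, S α).1) β hβ hxβ
  · intro α hα
    refine le_antisymm (fun x hx => ?_) (iSup₂_le fun β hβ => m2 hβ.le)
    obtain ⟨β, hβ, hxβ⟩ := hS.filtration_right.exists_lt α hα x.1 hx
    exact le_iSup₂ (f := fun β (_ : β < α) => (S β).2.submoduleOf (⨆ α, S α).2) β hβ hxβ
  · refine eq_top_iff.2 fun x _ => ?_
    obtain ⟨α, hα⟩ := u1 x.1 x.2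
    exact le_iSup (fun α => (S α).1.submoduleOf (⨆ α, S α).1) α hα
  · refine eq_top_iff.2 fun x _ => ?_
    obtain ⟨α, hα⟩ := u2 x.1 x.2
    exact le_iSup (fun α => (S α).2.submoduleOf (⨆ α, S α).2) α hα
  · exact fun α β hαβ => IsPureSubmodule.submoduleOf
      ((hS.good α).isPureSubmodule hp hS.hasPairing (le_iSup S α)) (m1 hαβ)
  · exact fun α β hαβ => IsPureSubmodule.submoduleOf
      ((hS.good α).swap.isPureSubmodule hp hS.hasPairing.swap
        (Prod.swap_le_swap.2 (le_iSup S α))) (m2 hαβ)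
  · exact fun α => (hS.good α).isCountableForm hp hS.hasPairing (le_iSup S α)
  · exact fun α => (hS.good α).isFinitelyCovered hp hS.hasPairing (le_iSup S α)

end GuessingChain

theorem exists_adicSeparated (R : Type u) [CommRing R] [IsDomain R] [IsPrincipalIdealRing R]
    (hR : ¬ IsField R) : ∃ p : R, p ≠ 0 ∧ ¬ IsUnit p ∧ AdicSeparated p := by
  obtain ⟨p, hp0, hp1⟩ := Ring.exists_not_isUnit_of_not_isField hR
  refine ⟨p, hp0, hp1, fun r hr => ?_⟩
  by_contra hr0
  obtain ⟨n, hn⟩ := FiniteMultiplicity.of_not_isUnit hp1 hr0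
  exact hn (hr _)

theorem theorem1p2 (hdiamond : DiamondAlephOne)
    (R : Type u) [CommRing R] [IsDomain R] [IsPrincipalIdealRing R] [Countable R]
    (hR : ¬ IsField R) :
    ∃ (G : Type u) (_ : AddCommGroup G) (_ : Module R G),
      -- `G` is reflexive, of cardinality `ℵ₁`, and not isomorphic to `R ⊕ G`
      Module.IsReflexive R G ∧ #G = ℵ₁ ∧ IsEmpty (G ≃ₗ[R] R × G) ∧
      -- `G` is the left part of a non-degenerate form, the union of a chain as described
      (∃ (H : Type u) (_ : AddCommGroup H) (_ : Module R H) (Φ : G →ₗ[R] H →ₗ[R] R)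
        (Gs : Set.Iio (ω₁ : Ordinal.{0}) → Submodule R G)
        (Hs : Set.Iio (ω₁ : Ordinal.{0}) → Submodule R H),
        Φ.Nondegenerate ∧ IsUnionOfFormChain Φ Gs Hs) ∧
      -- `G` is a dual module
      ∃ (D : Type u) (_ : AddCommGroup D) (_ : Module R D),
        Nonempty (G ≃ₗ[R] Module.Dual R D) := by
  obtain ⟨p, hp0, hp1, hp⟩ := exists_adicSeparated R hR
  obtain ⟨D, S, hS⟩ := hdiamond.exists_guessingChain hp hp0 hp1
  have hperf := hS.isPerfPair hp
  refine ⟨(⨆ α, S α).1, inferInstance, inferInstance,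
    Module.IsReflexive.of_isPerfPair (adicForm hp hS.hasPairing), hS.mk_eq hp,
    hS.isEmpty_linearEquiv hp, ⟨(⨆ α, S α).2, inferInstance, inferInstance,
      adicForm hp hS.hasPairing, _, _, ?_, hS.isUnionOfFormChain hp⟩,
    (⨆ α, S α).2, inferInstance, inferInstance,
    ⟨LinearEquiv.ofBijective (adicForm hp hS.hasPairing) hperf.bijective_left⟩⟩
  exact ⟨LinearMap.separatingLeft_iff_ker_eq_bot.2
      (LinearMap.ker_eq_bot.2 hperf.bijective_left.injective),
    LinearMap.separatingRight_iff_flip_ker_eq_bot.2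
      (LinearMap.ker_eq_bot.2 hperf.bijective_right.injective)⟩
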